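/- Setting. Let $\Gamma$ be a countable group acting by Borel automorphisms on a standard Borel probability space $(B,\nu)$, preserving the measure class of $\nu$, and essentially freely. Let $\lambda\in(0,1)$ and assume that for every $g\in\Gamma$ and $\nu$-a.e. $b\in B$ $$R(g,b):=\log_\lambda\frac{d(\nu\circ g)}{d\nu}(b)=-\log_\lambda\frac{d(\nu\circ g^{-1})}{d\nu}(gb)\in\mathbb Z ,\qquad (\nu\circ g)(A)=\nu(gA).$$ The discrete Maharam extension is the action $g(b,n)=(gb,n+R(g,b))$ on $B\times\mathbb Z$; it preserves $\nu\times\theta_\lambda$, $\theta_\lambda(\{n\})=\lambda^{-n}$. (A version of $R$ is fixed; on the null set where it is not a cocycle, the orbit relation is replaced by the equivalence relation generated by these maps. The same applies to the extension below.) Fix an integer $N\ge1$, let $I=\{0,\dots,N-1\}$, let $\mathcal R_I$ be the restriction to $B\times I$ of the orbit equivalence relation, and let $\theta_{\lambda,I}(\{n\})=\lambda^{-n}/(1+\lambda^{-1}+\dots+\lambda^{-N+1})$. For a p.m.p. action of $\Gamma$ on a standard probability space $(X,\mu)$ let $\Gamma$ act on $B\times X\times\mathbb Z$ by $g(b,x,n)=(gb,gx,n+R(g,b))$,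 and let $\widetilde{\mathcal R}_I$ be the restriction of its orbit relation to $B\times X\times I$, with classes $[b,x,t]$. Let $Y=B\times I$, $m=\nu\times\theta_{\lambda,I}$, and let the index set $\mathbb I$ be $\{1,2,3,\dots\}$ or $(0,\infty)$. A Borel family of subset functions is $\mathcal F=\{\mathcal F_r\}_{r\in\mathbb I}$, where $\mathcal F_r(y)$ is a subset of the $\mathcal R_I$-class of $y\in Y$, $\bigcup_{s\le r}\mathcal F_s(y)$ is finite for all $y,r$, and $\{(y,z,r): z\in\mathcal F_r(y)\}$ is Borel. Write $\mathcal F_r^{-1}(z)=\{y: z\in\mathcal F_r(y)\}$ and $\mathcal F_t^{-1}\mathcal F_r(y)=\bigcup_{z\in\mathcal F_r(y)}\mathcal F_t^{-1}(z)$. The family $\mathcal F$ is * *regular* if there is $C>0$ such that for a.e. $y$ and all $r$, $|\bigcup_{t\le r}\mathcal F_t^{-1}\mathcal F_r(y)|\le C|\mathcal F_r(y)|$; * *tempered* if $\mathbb I=\{1,2,\dots\}$ and there is $C>0$ such that for a.e. $y$ and all $n$, $|\bigcup_{m<n}\mathcal F_m^{-1}\mathcal F_n(y)|\le C|\mathcal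 F_n(y)|$; * *uniform* if there are $C,a_r,b_r>0$ with $b_r\le Ca_r$ such that $a_r\le|\mathcal F_r(y)|\le b_r$ and $a_r\le|\mathcal F_r^{-1}(y)|\le b_r$ for all $r$ and a.e. $y$; * *asymptotically invariant* if for a.e. $y$ all $\mathcal F_r(y)$ are non-empty, and there is a countable set $\Psi$ of Borel automorphisms of $Y$ with graphs in $\mathcal R_I$ which generates $\mathcal R_I$ (for a.e. $y$, every point of the class of $y$ is $\varphi(y)$ for some $\varphi$ in the group generated by $\Psi$) such that $|\mathcal F_r(y)\,\triangle\,\varphi(\mathcal F_r(y))|/|\mathcal F_r(y)|\to0$ as $r\to\infty$ for every $\varphi\in\Psi$ and a.e. $y$. The lift of $\mathcal F$ is $\widetilde{\mathcal F}_r(b,x,t)=\{(b',x',t')\in[b,x,t]:(b',t')\in\mathcal F_r(b,t)\}$. Put $\mathbb A[h|\widetilde{\mathcal F}_r](y)=|\widetilde{\mathcal F}_r(y)|^{-1}\sum_{y'\in\widetilde{\mathcal F}_r(y)}h(y')$ (zero if the set is empty). For $f$ on $B\times X\times I$ and a probability density $\psi\in L^1(B,\nu)$ (so $\psi\ge0$,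 $\int\psi\,d\nu=1$), put $$\mathbb M[f|\widetilde{\mathcal F},\psi](x)=\sup_{r\in\mathbb I}\int_B\frac1N\sum_{t=0}^{N-1}\mathbb A[|f|\,|\widetilde{\mathcal F}_r](b,x,t)\,\psi(b)\,d\nu(b).$$ $L^p$ norms of $f$ are with respect to $\nu\times\mu\times\theta_{\lambda,I}$; $f\in L\log L$ means $\int|f|\log^+|f|<\infty$, and $\|f\|_{L\log L}=\inf\{c>0:\int\frac{|f|}c\log^+\frac{|f|}c\le1\}$. Theorem. Let $\mathcal F$ be a Borel family of subset functions for $(B\times I,\nu\times\theta_{\lambda,I},\mathcal R_I)$ which is either regular, or asymptotically invariant, uniform and tempered. 1. For all $1<p\le\infty$ and $q$ with $\frac1p+\frac1q=1$ there is a constant $C_p<\infty$ such that for every p.m.p. action of $\Gamma$ on a standard probability space $(X,\mu)$, every $f\in L^p(B\times X\times I)$ and every probability density $\psi\in L^q(B,\nu)$, the function $\mathbb M[f|\widetilde{\mathcal F},\psi]$ is $\mu$-measurable and $$\|\mathbb M[f|\widetilde{\mathcal F},\psi]\|_{L^p(X,\mu)}\le C_p\|\psi\|_q\|f\|_p .$$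 2. There is a constant $C_1<\infty$ such that for every such $(X,\mu)$, every $f\in L\log L(B\times X\times I)$ and every probability density $\psi\in L^\infty(B,\nu)$, the function $\mathbb M[f|\widetilde{\mathcal F},\psi]$ is $\mu$-measurable and $$\|\mathbb M[f|\widetilde{\mathcal F},\psi]\|_{L^1(X,\mu)}\le C_1\|\psi\|_\infty\|f\|_{L\log L}.$$ In particular the constants do not depend on $f$, $\psi$ or the action on $(X,\mu)$. -/

import Mathlib

open MeasureTheory Filter Topology
open scoped ENNReal NNReal

/-! ### Subset functions of a countable equivalence relation -/

/-- The index set `{1, 2, 3, …}`, as a set of real numbers. -/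
def posNatIndex : Set ℝ := Set.range fun n : ℕ => ((n : ℝ) + 1)

/-- Cardinality of a set with values in `[0, ∞]` (infinite sets have cardinality `∞`). -/
noncomputable def eCard {Y : Type*} (S : Set Y) : ℝ≥0∞ := ((S.encard : ℕ∞) : ℝ≥0∞)

/-- The inverse `U⁻¹(y) = {x | y ∈ U x}` of a subset function. -/
def subsetInv {Y : Type*} (U : Y → Set Y) : Y → Set Y := fun y => {x | y ∈ U x}

/-- The product `(U V)(x) = ⋃ {U y | y ∈ V x}` of two subset functions. -/
def subsetMul {Y : Type*} (U V : Y → Set Y) : Y → Set Y := fun x => ⋃ y ∈ V x, U y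

/-- The average `|S|⁻¹ ∑_{y ∈ S} h y` of a nonnegative function (`0` if `S` is empty). -/
noncomputable def setAvg {Y : Type*} (S : Set Y) (h : Y → ℝ≥0∞) : ℝ≥0∞ :=
  (∑' y : S, h y) / eCard S

/-- A Borel family of subset functions indexed by `𝕀` for the relation `E`, with
`⋃_{s ≤ r} F_s(x)` finite for all `x` and `r`. -/
structure IsBorelFamily {Y : Type*} [MeasurableSpace Y] (E : Setoid Y) (𝕀 : Set ℝ)
    (F : 𝕀 → Y → Set Y) : Prop where
  subset_class : ∀ r x, ∀ y ∈ F r x, E x y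
  finite : ∀ (r : 𝕀) (x : Y), (⋃ s : 𝕀, ⋃ _ : s ≤ r, F s x).Finite
  measurable : MeasurableSet {z : Y × Y × 𝕀 | z.2.1 ∈ F z.2.2 z.1}

/-- The full group: Borel automorphisms whose graph is contained in the relation `E`. -/
def fullGroup {Y : Type*} [MeasurableSpace Y] (E : Setoid Y) : Subgroup (Equiv.Perm Y) where
  carrier := {φ | Measurable φ ∧ Measurable φ.symm ∧ ∀ x, E x (φ x)}
  one_mem' := ⟨measurable_id, measurable_id, fun x => E.refl x⟩
  mul_mem' := fun {a b} ha hb =>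
    ⟨ha.1.comp hb.1, hb.2.1.comp ha.2.1, fun x => E.trans (hb.2.2 x) (ha.2.2 (b x))⟩
  inv_mem' := fun {a} ha =>
    ⟨ha.2.1, ha.1, fun x => E.symm (by simpa using ha.2.2 (a⁻¹ x))⟩

/-- `Ψ` generates `E` modulo `m`: for almost every `x`, every `y` in the class of `x` is the
image of `x` under an element of the group generated by `Ψ`. -/
def GeneratesRel {Y : Type*} [MeasurableSpace Y] (E : Setoid Y) (m : Measure Y)
    (Ψ : Set (Equiv.Perm Y)) : Prop :=
  ∀ᵐ x ∂m, ∀ y, E x y → ∃ φ ∈ Subgroup.closure Ψ, φ x = y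

def IsAsymptoticallyInvariant {Y : Type*} [MeasurableSpace Y] (E : Setoid Y) (m : Measure Y)
    {𝕀 : Set ℝ} (F : 𝕀 → Y → Set Y) : Prop :=
  (∀ᵐ x ∂m, ∀ r, (F r x).Nonempty) ∧
  ∃ Ψ : Set (Equiv.Perm Y), Ψ.Countable ∧ Ψ ⊆ fullGroup E ∧ GeneratesRel E m Ψ ∧
    ∀ φ ∈ Ψ, ∀ᵐ x ∂m,
      Tendsto (fun r : 𝕀 => eCard (symmDiff (F r x) (φ '' F r x)) / eCard (F r x)) atTop (𝓝 0)

def IsUniformFamily {Y : Type*} [MeasurableSpace Y] (m : Measure Y)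
    {𝕀 : Set ℝ} (F : 𝕀 → Y → Set Y) : Prop :=
  ∃ (C : ℝ≥0) (a b : 𝕀 → ℝ≥0), 0 < C ∧ (∀ r, 0 < a r ∧ 0 < b r ∧ b r ≤ C * a r) ∧
    ∀ r, ∀ᵐ x ∂m, (a r ≤ eCard (F r x) ∧ eCard (F r x) ≤ b r) ∧
      (a r ≤ eCard (subsetInv (F r) x) ∧ eCard (subsetInv (F r) x) ≤ b r)

def IsRegularFamily {Y : Type*} [MeasurableSpace Y] (m : Measure Y)
    {𝕀 : Set ℝ} (F : 𝕀 → Y → Set Y) : Prop :=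
  ∃ C : ℝ≥0, 0 < C ∧ ∀ᵐ x ∂m, ∀ r : 𝕀,
    eCard (⋃ t : 𝕀, ⋃ _ : t ≤ r, subsetMul (subsetInv (F t)) (F r) x) ≤ C * eCard (F r x)

/-- Temperedness, which is only defined for families indexed by `{1, 2, 3, …}`. -/
def IsTemperedFamily {Y : Type*} [MeasurableSpace Y] (m : Measure Y)
    {𝕀 : Set ℝ} (F : 𝕀 → Y → Set Y) : Prop :=
  𝕀 = posNatIndex ∧ ∃ C : ℝ≥0, 0 < C ∧ ∀ᵐ x ∂m, ∀ r : 𝕀,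
    eCard (⋃ t : 𝕀, ⋃ _ : t < r, subsetMul (subsetInv (F t)) (F r) x) ≤ C * eCard (F r x)

/-! ### The discrete Maharam extension -/

/-- `log_lam (d(ν ∘ g)/dν (b))`, where `(ν ∘ g)(A) = ν (g A)`. By the chain rule this is
`- log_lam (d(ν ∘ g⁻¹)/dν)` evaluated at `g b`. -/
noncomputable def logRN {Γ B : Type*} [Group Γ] [MeasurableSpace B] [MulAction Γ B]
    (ν : Measure B) (lam : ℝ) (g : Γ) (b : B) : ℝ :=
  Real.logb lam ((ν.map fun b' => g⁻¹ • b').rnDeriv ν b).toReal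

/-- The orbit equivalence relation on `B × ℤ` of `g (b, n) = (g b, n + R g b)`. As a cocycle `R`
given by Radon-Nikodym derivatives is only determined almost everywhere, we take the equivalence
relation generated by these maps; it is the orbit relation wherever `R` satisfies the cocycle
identity. -/
def maharamRel {Γ B : Type*} [Group Γ] [MulAction Γ B] (R : Γ → B → ℤ) : Setoid (B × ℤ) :=
  Relation.EqvGen.setoid fun y z => ∃ g : Γ, z = (g • y.1, y.2 + R g y.1)

/-- The orbit equivalence relation on `B × X × ℤ` of `g (b, x, n) = (g b, g x, n + R g b)`. -/
def maharamRelExt {Γ B : Type*} (X : Type*) [Group Γ] [MulAction Γ B] [MulAction Γ X]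
    (R : Γ → B → ℤ) : Setoid (B × X × ℤ) :=
  Relation.EqvGen.setoid fun y z =>
    ∃ g : Γ, z = (g • y.1, g • y.2.1, y.2.2 + R g y.1)

/-- Restriction of `maharamRel` to `B × I`, where `I = {0, …, N - 1}`. -/
def maharamRelI {Γ B : Type*} [Group Γ] [MulAction Γ B] (R : Γ → B → ℤ) (N : ℕ) :
    Setoid (B × Fin N) :=
  (maharamRel R).comap fun y => (y.1, ((y.2 : ℕ) : ℤ))

/-- Restriction of `maharamRelExt` to `B × X × I`, where `I = {0, …, N - 1}`. -/
def maharamRelExtI {Γ B : Type*} (X : Type*) [Group Γ] [MulAction Γ B] [MulAction Γ X]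
    (R : Γ → B → ℤ) (N : ℕ) : Setoid (B × X × Fin N) :=
  (maharamRelExt X R).comap fun y => (y.1, y.2.1, ((y.2.2 : ℕ) : ℤ))

/-- The probability measure on `{0, …, N - 1}` with mass proportional to `lam ^ (-n)` at `n`. -/
noncomputable def thetaI (lam : ℝ) (N : ℕ) : Measure (Fin N) :=
  ∑ n : Fin N, ENNReal.ofReal (lam⁻¹ ^ (n : ℕ) / ∑ k : Fin N, lam⁻¹ ^ (k : ℕ)) • Measure.dirac n

/-- The lift of a subset function from `B × I` to `B × X × I`: the points of the class of
`(b, x, t)` that project into `U (b, t)`. -/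
def liftSubset {Γ B : Type*} (X : Type*) [Group Γ] [MulAction Γ B] [MulAction Γ X]
    (R : Γ → B → ℤ) (N : ℕ) (U : B × Fin N → Set (B × Fin N)) :
    B × X × Fin N → Set (B × X × Fin N) :=
  fun y => {z | (z.1, z.2.2) ∈ U (y.1, y.2.2) ∧ maharamRelExtI X R N y z}

/-- The weighted maximal function
`x ↦ sup_r ∫ N⁻¹ ∑_{t = 0}^{N - 1} A[|f| | lift of F_r](b, x, t) ψ(b) dν(b)`. -/
noncomputable def weightedMaximal {Γ B X : Type*} [Group Γ] [MeasurableSpace B] [MulAction Γ B]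
    [MulAction Γ X] (ν : Measure B) (R : Γ → B → ℤ) (N : ℕ) {𝕀 : Set ℝ}
    (F : 𝕀 → B × Fin N → Set (B × Fin N)) (f : B × X × Fin N → ℝ) (ψ : B → ℝ) (x : X) : ℝ≥0∞ :=
  ⨆ r : 𝕀, ∫⁻ b, ((N : ℝ≥0∞)⁻¹ *
    ∑ t : Fin N, setAvg (liftSubset X R N (F r) (b, x, t)) fun y => ‖f y‖ₑ) *
      ENNReal.ofReal (ψ b) ∂ν

/-! ### The space `L log L` -/

/-- `f ∈ L log L`, that is, `∫ |f| log⁺ |f| < ∞`. -/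
def MemLLogL {Y : Type*} [MeasurableSpace Y] (f : Y → ℝ) (m : Measure Y) : Prop :=
  AEStronglyMeasurable f m ∧ ∫⁻ y, ENNReal.ofReal (|f y| * Real.posLog |f y|) ∂m < ∞

/-- The (Luxemburg) norm of `L log L`:
the infimum of the `c > 0` with `∫ (|f| / c) log⁺ (|f| / c) ≤ 1`. -/
noncomputable def lLogLNorm {Y : Type*} [MeasurableSpace Y] (f : Y → ℝ) (m : Measure Y) : ℝ≥0∞ :=
  sInf {k : ℝ≥0∞ | ∃ c : ℝ, 0 < c ∧ k = ENNReal.ofReal c ∧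
    ∫⁻ y, ENNReal.ofReal (|f y| / c * Real.posLog (|f y| / c)) ∂m ≤ 1}

/-- `ψ` is a probability density on `(B, ν)`. -/
def IsProbDensity {B : Type*} [MeasurableSpace B] (ψ : B → ℝ) (ν : Measure B) : Prop :=
  Integrable ψ ν ∧ (∀ᵐ b ∂ν, 0 ≤ ψ b) ∧ ∫ b, ψ b ∂ν = 1

/-! ### Cardinalities and averages -/

/-! For fixed `x` the quantity to be bounded is an integral in `b`, so Hölder's inequality in `b`
reduces both parts to inequalities on `B × X × I` for a pointwise maximal function of the lifted
family. The lifted classes are traces of orbits of `Γ` on `B × X × ℤ`. This action preserves `ν × μ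
× θ_λ`, since the shift by `R g b` scales `θ_λ` by exactly the Radon-Nikodym factor of `g` on `B`
(`IsGoodSet.isMPAction_extMap`). Over an invariant conull subset of `B`, freeness identifies each `F
r (b, t)` with a finite set of group elements, its `returnSet`. The same group elements describe the
lift at `(b, x, t)` for every `x`, so the combinatorial conditions pass to the extension with
constants independent of `X`.

Two conditions matter: a point lying in `F r y` lies in at most `C |F r y|` of the sets of index
`r`, and the family is tempered. Under them the weak type (1,1) inequality follows from a covering
argument with weights in place of disjoint sets. For finitely many indices and a height `t`, let `S
z` be the set of largest index at `z` whose average exceeds `t`, and treat the indices in decreasing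
order. The point `z` receives the weight `(1 - c) / (C |S z|)`, where `c` is the weight already
given to points whose sets meet that of `z`. The incidence bound shows that no point is covered with
total weight above `1` (`coverSum_packingWeight_le_one`). Temperedness and mass transport show that
the weighted total size of the sets is at least the measure of the exceptional set divided by `2 C`
(`measure_le_lintegral_packingWeight`). Comparing the two gives the inequality
(`mul_measure_le_of_packing`). The layer cake formula turns it into the `L^p` and `L log L` bounds;
the latter uses that the maximal function lives on `B × X × I`, of finite measure.

With an uncountable index set the pointwise supremum may be neither measurable nor controlled.
Separability of `L¹` yields one sequence of indices along which every `F r` is almost everywhere an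
eventually constant limit, and by Fatou's lemma this sequence computes the supremum of the integrals
in `b` (`weightedMaximal_eq_iSup_seq`). -/

lemma eCard_eq_tsum {Y : Type*} (S : Set Y) : eCard S = ∑' y, S.indicator (fun _ => (1 : ℝ≥0∞)) y := by
  rw [← tsum_subtype S (fun _ => (1 : ℝ≥0∞)), ENNReal.tsum_set_one]
  rfl

lemma eCard_mono {Y : Type*} {S S' : Set Y} (h : S ⊆ S') : eCard S ≤ eCard S' := by
  unfold eCard
  exact_mod_cast Set.encard_le_encard h

lemma eCard_image {Y Y' : Type*} {S : Set Y} {j : Y → Y'} (h : Set.InjOn j S) :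
    eCard (j '' S) = eCard S := by
  unfold eCard
  rw [h.encard_image]

lemma eCard_ne_top {Y : Type*} {S : Set Y} (h : S.Finite) : eCard S ≠ ∞ := by
  unfold eCard
  simpa using h

lemma eCard_eq_zero {Y : Type*} {S : Set Y} : eCard S = 0 ↔ S = ∅ := by
  unfold eCard
  simp

lemma setAvg_image {Y Y' : Type*} {S : Set Y} {j : Y → Y'} (hj : Set.InjOn j S) (h : Y' → ℝ≥0∞) :
    setAvg (j '' S) h = setAvg S fun y => h (j y) := by
  unfold setAvg
  rw [eCard_image hj]
  congr 1
  exact tsum_image h hj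

lemma setAvg_mono {Y : Type*} {S : Set Y} {h h' : Y → ℝ≥0∞} (H : ∀ y ∈ S, h y ≤ h' y) :
    setAvg S h ≤ setAvg S h' := by
  unfold setAvg
  exact ENNReal.div_le_div_right (ENNReal.tsum_le_tsum fun y : S => H y.1 y.2) _

lemma setAvg_congr {Y : Type*} {S : Set Y} {h h' : Y → ℝ≥0∞} (H : ∀ y ∈ S, h y = h' y) :
    setAvg S h = setAvg S h' :=
  le_antisymm (setAvg_mono fun y hy => (H y hy).le) (setAvg_mono fun y hy => (H y hy).ge)

lemma setAvg_const_le {Y : Type*} {S : Set Y} (c : ℝ≥0∞) : setAvg S (fun _ => c) ≤ c := by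
  unfold setAvg
  rw [ENNReal.tsum_const]
  refine ENNReal.div_le_of_le_mul ?_
  rw [mul_comm]
  rfl

lemma setAvg_add {Y : Type*} {S : Set Y} (h h' : Y → ℝ≥0∞) :
    setAvg S (fun y => h y + h' y) = setAvg S h + setAvg S h' := by
  unfold setAvg
  rw [ENNReal.tsum_add, ENNReal.add_div]

/-! ### Countable measure preserving actions and mass transport -/

/-- A (left) action `T` of `Γ` on `Z` by maps preserving the measure `m`. -/
structure IsMPAction {Γ Z : Type*} [Group Γ] [MeasurableSpace Z] (T : Γ → Z → Z)
    (m : Measure Z) : Prop where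
  one : ∀ z, T 1 z = z
  mul : ∀ g h z, T (g * h) z = T g (T h z)
  measurePreserving : ∀ g, MeasurePreserving (T g) m m

section MPAction

variable {Γ Z : Type*} [Group Γ] [MeasurableSpace Z] {T : Γ → Z → Z} {m : Measure Z}

lemma IsMPAction.inv_apply (hT : IsMPAction T m) (g : Γ) (z : Z) : T g⁻¹ (T g z) = z := by
  rw [← hT.mul, inv_mul_cancel, hT.one]

lemma IsMPAction.measurable (hT : IsMPAction T m) (g : Γ) : Measurable (T g) :=
  (hT.measurePreserving g).measurable

/-- The mass transport principle. -/
lemma IsMPAction.lintegral_tsum (hT : IsMPAction T m) [Countable Γ] {K : Γ → Z → ℝ≥0∞}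
    (hK : ∀ g, Measurable (K g)) :
    ∫⁻ z, ∑' g, K g z ∂m = ∫⁻ z, ∑' g, K g⁻¹ (T g z) ∂m := by
  have hK' : ∀ g, AEMeasurable (fun z => K g⁻¹ (T g z)) m :=
    fun g => ((hK g⁻¹).comp (hT.measurable g)).aemeasurable
  -- After inversion of the summation index, each term is one instance of the invariance of `m`.
  rw [MeasureTheory.lintegral_tsum fun g => (hK g).aemeasurable,
    MeasureTheory.lintegral_tsum hK', ← (Equiv.inv Γ).tsum_eq]
  exact tsum_congr fun g => ((hT.measurePreserving g).lintegral_comp (hK g⁻¹)).symm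

end MPAction

/-! ### Fractional packings -/

section Packing

variable {Γ Z : Type*} [Group Γ] (T : Γ → Z → Z) (S : Z → Set Γ)

/-- The total weight at `z` of the sets `S y • y` covering `z`. -/
noncomputable def coverSum (w : Z → ℝ≥0∞) (z : Z) : ℝ≥0∞ :=
  ∑' h, {z | h⁻¹ ∈ S (T h z)}.indicator (fun z => w (T h z)) z

/-- The points `z` such that the sets `S z • z` and `S y • y`, where `y = h • z`, meet. -/
def conflictSet (h : Γ) : Set Z := {z | ∃ g ∈ S z, g * h⁻¹ ∈ S (T h z)}

/-- The total weight of the points `y` such that `S y • y` meets `S z • z`. -/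
noncomputable def conflictSum (w : Z → ℝ≥0∞) (z : Z) : ℝ≥0∞ :=
  ∑' h, (conflictSet T S h).indicator (fun z => w (T h z)) z

/-- The greedy fractional packing: the levels `ℓ` are treated in increasing order, and a point
receives the share of its weight that the previous levels leave. -/
noncomputable def packingWeight (ℓ : Z → ℕ) (C : ℝ≥0∞) : ℕ → Z → ℝ≥0∞
  | 0 => 0
  | k + 1 => fun z => packingWeight ℓ C k z +
      {z | ℓ z = k}.indicator
        (fun z => (1 - conflictSum T S (packingWeight ℓ C k) z) / (C * eCard (S z))) z

variable {T S} {ℓ : Z → ℕ} {C : ℝ≥0∞}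

/-- A point is given weight only when its own level is treated: the weight is `0` before that and
frozen afterwards. This lemma and the next two record it. -/
lemma packingWeight_of_le {k : ℕ} {z : Z} (h : k ≤ ℓ z) : packingWeight T S ℓ C k z = 0 := by
  induction k with
  | zero => rfl
  | succ k ih =>
    have : ℓ z ≠ k := by omega
    simp [packingWeight, ih (by omega), this]

lemma packingWeight_of_lt {k : ℕ} {z : Z} (h : ℓ z < k) :
    packingWeight T S ℓ C k z =
      (1 - conflictSum T S (packingWeight T S ℓ C (ℓ z)) z) / (C * eCard (S z)) := by
  induction k with
  | zero => omega
  | succ k ih =>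
    rcases Nat.lt_succ_iff_lt_or_eq.1 h with h' | h'
    · have : ℓ z ≠ k := by omega
      simp [packingWeight, ih h', this]
    · subst h'
      simp [packingWeight, packingWeight_of_le (T := T) (S := S) (C := C) (le_refl (ℓ z))]

lemma packingWeight_eq_of_lt {k n : ℕ} {z : Z} (h : ℓ z < k) (hkn : k ≤ n) :
    packingWeight T S ℓ C k z = packingWeight T S ℓ C n z := by
  rw [packingWeight_of_lt h, packingWeight_of_lt (h.trans_le hkn)]

section Measurability

variable [MeasurableSpace Z] [Countable Γ]

omit [Group Γ] in
lemma measurable_eCard (hS : ∀ g, MeasurableSet {z | g ∈ S z}) :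
    Measurable fun z => eCard (S z) := by
  simp only [eCard_eq_tsum]
  refine Measurable.tsum fun g => ?_
  exact (measurable_const.indicator (hS g) : Measurable ({z | g ∈ S z}.indicator fun _ => (1 : ℝ≥0∞)))

lemma measurableSet_conflictSet (hT : ∀ g, Measurable (T g))
    (hS : ∀ g, MeasurableSet {z | g ∈ S z}) (h : Γ) : MeasurableSet (conflictSet T S h) := by
  have : conflictSet T S h = ⋃ g, ({z | g ∈ S z} ∩ T h ⁻¹' {z | g * h⁻¹ ∈ S z}) := by
    ext z; simp [conflictSet]
  rw [this]
  exact MeasurableSet.iUnion fun g => (hS g).inter (hT h (hS _))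

lemma measurable_conflictSum (hT : ∀ g, Measurable (T g))
    (hS : ∀ g, MeasurableSet {z | g ∈ S z}) {w : Z → ℝ≥0∞} (hw : Measurable w) :
    Measurable (conflictSum T S w) :=
  Measurable.tsum fun h =>
    (hw.comp (hT h)).indicator (measurableSet_conflictSet hT hS h)

lemma measurable_packingWeight (hT : ∀ g, Measurable (T g))
    (hS : ∀ g, MeasurableSet {z | g ∈ S z}) (hℓ : Measurable ℓ) (k : ℕ) :
    Measurable (packingWeight T S ℓ C k) := by
  induction k with
  | zero => exact measurable_const
  | succ k ih =>
    refine ih.add (Measurable.indicator ?_ (hℓ (measurableSet_singleton k)))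
    exact (measurable_const.sub (measurable_conflictSum hT hS ih)).div
      (measurable_const.mul (measurable_eCard hS))

end Measurability

/-- The greedy fractional packing covers every point at most once. -/
lemma coverSum_packingWeight_le_one (hmul : ∀ g h z, T (g * h) z = T g (T h z))
    {n : ℕ} (hincid : ∀ z h, ℓ (T h z) < n → h⁻¹ ∈ S (T h z) →
      eCard {h' | ℓ (T h' z) = ℓ (T h z) ∧ h'⁻¹ ∈ S (T h' z)} ≤ C * eCard (S (T h z)))
    {k : ℕ} (hk : k ≤ n) (z : Z) :
    coverSum T S (packingWeight T S ℓ C k) z ≤ 1 := by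
  induction k with
  | zero => simp [coverSum, packingWeight]
  | succ k ih =>
    have ih := ih (by omega)
    set w := packingWeight T S ℓ C k with hw
    set Λ := coverSum T S w z with hΛ
    set H : Set Γ := {h | ℓ (T h z) = k ∧ h⁻¹ ∈ S (T h z)} with hH
    -- If `y = h • z` covers `z`, every point covering `z` is in conflict with `y`, because `z` is a
    -- common point of the two sets. So the conflict sum at `y` is at least `Λ`.
    have hbound : ∀ h, h⁻¹ ∈ S (T h z) → 1 - conflictSum T S w (T h z) ≤ 1 - Λ := by
      intro h hh
      refine tsub_le_tsub_left ?_ _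
      rw [hΛ, coverSum, conflictSum, ← (Equiv.mulRight h⁻¹).tsum_eq (fun h' =>
        (conflictSet T S h').indicator (fun z => w (T h' z)) (T h z))]
      refine ENNReal.tsum_le_tsum fun h' => ?_
      refine Set.indicator_apply_le' (fun hh' => ?_) fun _ => zero_le
      have hz : T (h' * h⁻¹) (T h z) = T h' z := by
        rw [← hmul, inv_mul_cancel_right]
      have : T h z ∈ conflictSet T S (h' * h⁻¹) := by
        refine ⟨h⁻¹, hh, ?_⟩
        rw [hz]
        simpa using hh'
      simp [this, hz]
    -- The `|H|` points `y` of level `k` covering `z` satisfy `|H| ≤ C |S y|`, so each adds at most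
    -- `(1 - Λ) / |H|`, and the whole level at most `1 - Λ`.
    have hstep : ∀ h, {z | h⁻¹ ∈ S (T h z)}.indicator
        (fun z => packingWeight T S ℓ C (k + 1) (T h z)) z ≤
        {z | h⁻¹ ∈ S (T h z)}.indicator (fun z => w (T h z)) z +
          H.indicator (fun _ => (1 - Λ) / eCard H) h := by
      intro h
      by_cases hh : h⁻¹ ∈ S (T h z)
      · by_cases hk' : ℓ (T h z) = k
        · have hmem : h ∈ H := ⟨hk', hh⟩
          have hle : eCard H ≤ C * eCard (S (T h z)) := by
            have := hincid z h (by omega) hh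
            rwa [hk'] at this
          simp only [packingWeight, Set.indicator, Set.mem_ofPred_eq, hh, hk', hmem, if_true, ← hw]
          exact add_le_add_right (ENNReal.div_le_div (hbound h hh) hle) _
        · simp [packingWeight, hh, hk', ← hw]
      · simp [hh]
    calc coverSum T S (packingWeight T S ℓ C (k + 1)) z
        ≤ ∑' h, ({z | h⁻¹ ∈ S (T h z)}.indicator (fun z => w (T h z)) z +
          H.indicator (fun _ => (1 - Λ) / eCard H) h) := ENNReal.tsum_le_tsum hstep
      _ = Λ + (1 - Λ) / eCard H * eCard H := by
        rw [ENNReal.tsum_add]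
        congr 1
        rw [eCard_eq_tsum H, ← ENNReal.tsum_mul_left]
        refine tsum_congr fun h => ?_
        by_cases hh : h ∈ H <;> simp [hh]
      _ ≤ Λ + (1 - Λ) := by exact add_le_add_right (ENNReal.mul_le_of_le_div le_rfl) _
      _ = 1 := add_tsub_cancel_of_le ih

/-! ### Total mass of the greedy packing -/

section Measure

variable [MeasurableSpace Z] [Countable Γ] {m : Measure Z}

/-- A point is paid for either by its own weight or by the weights of the earlier points in conflict
with it. By mass transport the second payment is charged to the earlier point `z`, at most `C |S z|`
times by temperedness. The two payments account for the factor `2`. -/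
lemma measure_le_lintegral_packingWeight (hT : IsMPAction T m) {n : ℕ} (hC0 : C ≠ 0) (hC : C ≠ ∞)
    (hS : ∀ g, MeasurableSet {z | g ∈ S z}) (hℓ : Measurable ℓ)
    (hfin : ∀ z, ℓ z < n → (S z).Finite) (hne : ∀ z, ℓ z < n → (S z).Nonempty)
    (htemp : ∀ z, ℓ z < n →
      eCard {h | (ℓ z < ℓ (T h z) ∧ ℓ (T h z) < n) ∧ z ∈ conflictSet T S h} ≤ C * eCard (S z)) :
    m {z | ℓ z < n} ≤
      2 * C * ∫⁻ z, packingWeight T S ℓ C n z * eCard (S z) ∂m := by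
  set w := packingWeight T S ℓ C n with hw
  have hwm : Measurable w := measurable_packingWeight hT.measurable hS hℓ n
  have hcm : Measurable fun z => eCard (S z) := measurable_eCard hS
  set K : Γ → Z → ℝ≥0∞ := fun h =>
    {z | (ℓ (T h z) < ℓ z ∧ ℓ z < n) ∧ z ∈ conflictSet T S h}.indicator fun z => w (T h z) with hK
  have hKm : ∀ h, Measurable (K h) := by
    intro h
    refine (hwm.comp (hT.measurable h)).indicator ?_
    exact ((measurableSet_lt (hℓ.comp (hT.measurable h)) hℓ).inter
      (measurableSet_lt hℓ measurable_const)).inter (measurableSet_conflictSet hT.measurable hS h)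
  have hDm : MeasurableSet {z | ℓ z < n} := measurableSet_lt hℓ measurable_const
  have hpt : ∀ z, {z | ℓ z < n}.indicator (fun _ => (1 : ℝ≥0∞)) z ≤
      C * (w z * eCard (S z)) + ∑' h, K h z := by
    intro z
    refine Set.indicator_apply_le' (fun hz => ?_) fun _ => zero_le
    have h1 : conflictSum T S (packingWeight T S ℓ C (ℓ z)) z ≤ ∑' h, K h z := by
      refine ENNReal.tsum_le_tsum fun h => ?_
      refine Set.indicator_apply_le' (fun hh => ?_) fun _ => zero_le
      by_cases hlt : ℓ (T h z) < ℓ z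
      · have : z ∈ {z | (ℓ (T h z) < ℓ z ∧ ℓ z < n) ∧ z ∈ conflictSet T S h} := ⟨⟨hlt, hz⟩, hh⟩
        rw [hK, packingWeight_eq_of_lt hlt (le_of_lt hz)]
        simp only [Set.indicator_of_mem this, ← hw, le_refl]
      · rw [packingWeight_of_le (not_lt.1 hlt)]
        exact zero_le
    have hc0 : C * eCard (S z) ≠ 0 :=
      mul_ne_zero hC0 (by rw [Ne, eCard_eq_zero]; exact (hne z hz).ne_empty)
    have hct : C * eCard (S z) ≠ ∞ := ENNReal.mul_ne_top hC (eCard_ne_top (hfin z hz))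
    have h2 : C * (w z * eCard (S z)) =
        1 - conflictSum T S (packingWeight T S ℓ C (ℓ z)) z := by
      rw [hw, packingWeight_of_lt hz, mul_comm (_ / _), ← mul_assoc,
        ENNReal.mul_div_cancel hc0 hct]
    rw [h2]
    exact le_tsub_add.trans (add_le_add_right h1 _)
  have hKint : ∫⁻ z, ∑' h, K h z ∂m ≤ ∫⁻ z, C * (w z * eCard (S z)) ∂m := by
    rw [hT.lintegral_tsum hKm]
    refine lintegral_mono fun z => ?_
    by_cases hz : ℓ z < n
    · calc ∑' h, K h⁻¹ (T h z)
          ≤ ∑' h, w z * {h | (ℓ z < ℓ (T h z) ∧ ℓ (T h z) < n) ∧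
              z ∈ conflictSet T S h}.indicator (fun _ => (1 : ℝ≥0∞)) h := by
            refine ENNReal.tsum_le_tsum fun h => ?_
            refine Set.indicator_apply_le' (fun hh => ?_) fun _ => zero_le
            simp only [Set.mem_ofPred_eq, conflictSet, hT.inv_apply, inv_inv] at hh
            obtain ⟨hlt, g, hg, hg'⟩ := hh
            have : h ∈ {h | (ℓ z < ℓ (T h z) ∧ ℓ (T h z) < n) ∧ z ∈ conflictSet T S h} :=
              -- Conflict is symmetric: the common point `g • (h • z)` is `(g * h) • z` when seen
              -- from `z`.
              ⟨hlt, g * h, hg', by simpa using hg⟩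
            rw [Set.indicator_of_mem this, hT.inv_apply, mul_one]
        _ = w z * eCard {h | (ℓ z < ℓ (T h z) ∧ ℓ (T h z) < n) ∧ z ∈ conflictSet T S h} := by
            rw [ENNReal.tsum_mul_left, eCard_eq_tsum]
        _ ≤ w z * (C * eCard (S z)) := by gcongr; exact htemp z hz
        _ = C * (w z * eCard (S z)) := by ring
    · have : ∀ h, K h⁻¹ (T h z) = 0 := by
        intro h
        refine Set.indicator_apply_eq_zero.2 fun _ => ?_
        rw [hT.inv_apply, hw, packingWeight_of_le (not_lt.1 hz)]
      simp [this]
  calc m {z | ℓ z < n} = ∫⁻ z, {z | ℓ z < n}.indicator (fun _ => (1 : ℝ≥0∞)) z ∂m := by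
        rw [lintegral_indicator hDm, setLIntegral_const, one_mul]
    _ ≤ ∫⁻ z, (C * (w z * eCard (S z)) + ∑' h, K h z) ∂m := lintegral_mono hpt
    _ = ∫⁻ z, C * (w z * eCard (S z)) ∂m + ∫⁻ z, ∑' h, K h z ∂m :=
        lintegral_add_left ((hwm.mul hcm).const_mul C) _
    _ ≤ ∫⁻ z, C * (w z * eCard (S z)) ∂m + ∫⁻ z, C * (w z * eCard (S z)) ∂m := by gcongr
    _ = 2 * C * ∫⁻ z, w z * eCard (S z) ∂m := by
        rw [lintegral_const_mul C (f := fun z => w z * eCard (S z)) (hwm.mul hcm)]; ring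

/-- A weak type inequality for a single choice `S` of finite sets, with levels `ℓ`. -/
lemma mul_measure_le_of_packing (hT : IsMPAction T m) {n : ℕ} (hC0 : C ≠ 0) (hC : C ≠ ∞)
    (hS : ∀ g, MeasurableSet {z | g ∈ S z}) (hℓ : Measurable ℓ)
    (hfin : ∀ z, ℓ z < n → (S z).Finite) (hne : ∀ z, ℓ z < n → (S z).Nonempty)
    (hincid : ∀ z h, ℓ (T h z) < n → h⁻¹ ∈ S (T h z) →
      eCard {h' | ℓ (T h' z) = ℓ (T h z) ∧ h'⁻¹ ∈ S (T h' z)} ≤ C * eCard (S (T h z)))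
    (htemp : ∀ z, ℓ z < n →
      eCard {h | (ℓ z < ℓ (T h z) ∧ ℓ (T h z) < n) ∧ z ∈ conflictSet T S h} ≤ C * eCard (S z))
    {f : Z → ℝ≥0∞} (hf : Measurable f) {t : ℝ≥0∞}
    (ht : ∀ z, ℓ z < n → t * eCard (S z) ≤ ∑' g, {z | g ∈ S z}.indicator (fun z => f (T g z)) z) :
    t * m {z | ℓ z < n} ≤ 2 * C * ∫⁻ z, f z ∂m := by
  set w := packingWeight T S ℓ C n with hw
  have hwm : Measurable w := measurable_packingWeight hT.measurable hS hℓ n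
  have hcm : Measurable fun z => eCard (S z) := measurable_eCard hS
  set K : Γ → Z → ℝ≥0∞ := fun g => {z | g ∈ S z}.indicator fun z => w z * f (T g z) with hK
  have hKm : ∀ g, Measurable (K g) :=
    fun g => (hwm.mul (hf.comp (hT.measurable g))).indicator (hS g)
  -- Every set of positive weight has average at least `t`. Mass transport converts the weighted
  -- sums of `f` over these sets into the integral of `f` times the cover sum, which is at most `1`.
  have key : t * ∫⁻ z, w z * eCard (S z) ∂m ≤ ∫⁻ z, f z ∂m := by
    calc t * ∫⁻ z, w z * eCard (S z) ∂m = ∫⁻ z, t * (w z * eCard (S z)) ∂m :=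
          (lintegral_const_mul _ (hwm.mul hcm)).symm
      _ ≤ ∫⁻ z, ∑' g, K g z ∂m := by
          refine lintegral_mono fun z => ?_
          by_cases hz : ℓ z < n
          · calc t * (w z * eCard (S z)) = w z * (t * eCard (S z)) := by ring
              _ ≤ w z * ∑' g, {z | g ∈ S z}.indicator (fun z => f (T g z)) z := by
                  gcongr; exact ht z hz
              _ = ∑' g, K g z := by
                  rw [← ENNReal.tsum_mul_left]
                  refine tsum_congr fun g => ?_
                  by_cases hg : g ∈ S z <;> simp [hK, hg]
          · have : w z = 0 := by rw [hw, packingWeight_of_le (not_lt.1 hz)]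
            simp [this]
      _ = ∫⁻ z, ∑' g, K g⁻¹ (T g z) ∂m := hT.lintegral_tsum hKm
      _ ≤ ∫⁻ z, f z ∂m := by
          refine lintegral_mono fun z => ?_
          calc ∑' g, K g⁻¹ (T g z) = coverSum T S w z * f z := by
                rw [coverSum, ← ENNReal.tsum_mul_right]
                refine tsum_congr fun g => ?_
                by_cases hg : g⁻¹ ∈ S (T g z) <;> simp [hK, hg, hT.inv_apply]
            _ ≤ 1 * f z := by
                gcongr
                exact coverSum_packingWeight_le_one hT.mul hincid le_rfl z
            _ = f z := one_mul _
  calc t * m {z | ℓ z < n} ≤ t * (2 * C * ∫⁻ z, w z * eCard (S z) ∂m) := by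
        gcongr
        exact measure_le_lintegral_packingWeight hT hC0 hC hS hℓ hfin hne htemp
    _ = 2 * C * (t * ∫⁻ z, w z * eCard (S z) ∂m) := by ring
    _ ≤ 2 * C * ∫⁻ z, f z ∂m := by gcongr

end Measure

end Packing

/-! ### Maximal functions of families of finite sets -/

lemma Finset.exists_strictAnti_enumeration {ι : Type*} [LinearOrder ι] (i₀ : ι) (Q : Finset ι) :
    ∃ (n : ℕ) (r : ℕ → ι), (∀ i j, i < j → j < n → r j < r i) ∧ (∀ k < n, r k ∈ Q) ∧
      ∀ i ∈ Q, ∃ k < n, r k = i := by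
  induction Q using Finset.induction_on_min with
  | empty => exact ⟨0, fun _ => i₀, by simp, by simp, by simp⟩
  | insert a s ha ih =>
    obtain ⟨n, r, h1, h2, h3⟩ := ih
    refine ⟨n + 1, fun k => if k < n then r k else a, ?_, ?_, ?_⟩
    · intro i j hij hj
      by_cases hjn : j < n
      · simpa [hjn, hij.trans hjn] using h1 i j hij hjn
      · have hi : i < n := by omega
        simpa [hjn, hi] using ha _ (h2 i hi)
    · intro k hk
      by_cases hkn : k < n
      · simp [hkn, h2 k hkn]
      · simp [hkn]
    · intro i hi
      rcases Finset.mem_insert.1 hi with rfl | hi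
      · exact ⟨n, by omega, by simp⟩
      · obtain ⟨k, hk, rfl⟩ := h3 i hi
        exact ⟨k, by omega, by simp [hk]⟩

section Maximal

variable {Γ Z ι : Type*} [Group Γ] (T : Γ → Z → Z) (Φ : ι → Z → Set Γ)

/-- The average of `f` over `Φ i z • z`. -/
noncomputable def orbitAvg (f : Z → ℝ≥0∞) (i : ι) (z : Z) : ℝ≥0∞ :=
  setAvg (Φ i z) fun g => f (T g z)

/-- The maximal function along the sequence `q` of indices. -/
noncomputable def orbitMax (q : ℕ → ι) (f : Z → ℝ≥0∞) (z : Z) : ℝ≥0∞ :=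
  ⨆ n, orbitAvg T Φ f (q n) z

/-- The combinatorial conditions behind the maximal inequality: bounded incidence within each
index, and temperedness with respect to smaller indices. -/
structure IsTemperedAction [LinearOrder ι] (I : Set ι) (C : ℝ≥0∞) : Prop where
  finite : ∀ i z, (Φ i z).Finite
  incidence : ∀ i ∈ I, ∀ z h, h⁻¹ ∈ Φ i (T h z) →
    eCard {h' | h'⁻¹ ∈ Φ i (T h' z)} ≤ C * eCard (Φ i (T h z))
  tempered : ∀ i ∈ I, ∀ z,
    eCard {h | ∃ j ∈ I, j < i ∧ ∃ g ∈ Φ i z, g * h⁻¹ ∈ Φ j (T h z)} ≤ C * eCard (Φ i z)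

variable {T Φ}

omit [Group Γ] in
lemma orbitAvg_eq_tsum (f : Z → ℝ≥0∞) (i : ι) (z : Z) :
    orbitAvg T Φ f i z =
      (∑' g, {z | g ∈ Φ i z}.indicator (fun z => f (T g z)) z) / eCard (Φ i z) := by
  unfold orbitAvg setAvg
  rw [tsum_subtype (Φ i z) fun g => f (T g z)]
  congr 1

variable [MeasurableSpace Z] [Countable Γ] {m : Measure Z}

omit [Group Γ] in
lemma measurable_orbitAvg (hT : ∀ g, Measurable (T g)) {i : ι}
    (hΦ : ∀ g, MeasurableSet {z | g ∈ Φ i z}) {f : Z → ℝ≥0∞} (hf : Measurable f) :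
    Measurable (orbitAvg T Φ f i) := by
  have : orbitAvg T Φ f i = fun z =>
      (∑' g, {z | g ∈ Φ i z}.indicator (fun z => f (T g z)) z) / eCard (Φ i z) :=
    funext fun z => orbitAvg_eq_tsum f i z
  rw [this]
  exact (Measurable.tsum fun g => (hf.comp (hT g)).indicator (hΦ g)).div (measurable_eCard hΦ)

omit [Group Γ] in
lemma measurable_orbitMax (hT : ∀ g, Measurable (T g))
    (hΦ : ∀ i g, MeasurableSet {z | g ∈ Φ i z}) (q : ℕ → ι) {f : Z → ℝ≥0∞} (hf : Measurable f) :
    Measurable (orbitMax T Φ q f) :=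
  Measurable.iSup fun n => measurable_orbitAvg hT (hΦ (q n)) hf

variable [LinearOrder ι] {I : Set ι} {C : ℝ≥0∞}

lemma mul_measure_exists_lt_orbitAvg_le (hT : IsMPAction T m) (hC0 : C ≠ 0) (hC : C ≠ ∞)
    (hΦ : ∀ i g, MeasurableSet {z | g ∈ Φ i z}) (hΦI : IsTemperedAction T Φ I C)
    (Q : Finset ι) (hQ : ↑Q ⊆ I) {f : Z → ℝ≥0∞} (hf : Measurable f) (t : ℝ≥0∞) :
    t * m {z | ∃ i ∈ Q, t < orbitAvg T Φ f i z} ≤ 2 * C * ∫⁻ z, f z ∂m := by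
  rcases Q.eq_empty_or_nonempty with rfl | ⟨i₀, -⟩
  · simp
  obtain ⟨n, r, hr, hrQ, hQr⟩ := Q.exists_strictAnti_enumeration i₀
  classical
  -- The indices are enumerated in decreasing order, so the least `k` picks the largest index of `Q`
  -- at which the average exceeds `t`. The value `n` means that there is none.
  have hex : ∀ z, ∃ k, k = n ∨ t < orbitAvg T Φ f (r k) z := fun z => ⟨n, Or.inl rfl⟩
  set ℓ : Z → ℕ := fun z => Nat.find (hex z) with hℓ
  have hℓm : Measurable ℓ := by
    refine measurable_find hex fun k => ?_
    exact (MeasurableSet.const _).union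
      (measurableSet_lt measurable_const (measurable_orbitAvg hT.measurable (hΦ _) hf))
  have hℓlt : ∀ z, ℓ z < n → t < orbitAvg T Φ f (r (ℓ z)) z := fun z hz =>
    (Nat.find_spec (hex z)).resolve_left hz.ne
  have hset : {z | ∃ i ∈ Q, t < orbitAvg T Φ f i z} ⊆ {z | ℓ z < n} := by
    rintro z ⟨i, hi, hit⟩
    obtain ⟨k, hk, rfl⟩ := hQr i hi
    exact lt_of_le_of_lt (Nat.find_min' (hex z) (Or.inr hit)) hk
  set S : Z → Set Γ := fun z => Φ (r (ℓ z)) z with hS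
  have hSm : ∀ g, MeasurableSet {z | g ∈ S z} := by
    intro g
    have : {z | g ∈ S z} = ⋃ k, ({z | ℓ z = k} ∩ {z | g ∈ Φ (r k) z}) := by
      ext z; simp [hS]
    rw [this]
    exact MeasurableSet.iUnion fun k => (hℓm (measurableSet_singleton k)).inter (hΦ _ _)
  have havg : ∀ z, ℓ z < n →
      t * eCard (S z) ≤ ∑' g, {z | g ∈ S z}.indicator (fun z => f (T g z)) z := by
    intro z hz
    have := (hℓlt z hz).le
    rw [orbitAvg_eq_tsum] at this
    exact ENNReal.mul_le_of_le_div this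
  -- An empty set has average `0`, which does not exceed `t`.
  have hne : ∀ z, ℓ z < n → (S z).Nonempty := by
    intro z hz
    rw [Set.nonempty_iff_ne_empty]
    intro h0
    have h1 := hℓlt z hz
    have h2 : Φ (r (ℓ z)) z = ∅ := h0
    simp [orbitAvg, setAvg, h2] at h1
  refine (mul_le_mul_right (measure_mono hset) t).trans ?_
  refine mul_measure_le_of_packing hT hC0 hC hSm hℓm (fun z _ => hΦI.finite _ z) hne ?_ ?_ hf havg
  · intro z h hlt hh
    refine le_trans (eCard_mono ?_) (hΦI.incidence _ (hQ (hrQ _ hlt)) z h hh)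
    rintro h' ⟨hh1, hh2⟩
    have hh3 : h'⁻¹ ∈ Φ (r (ℓ (T h' z))) (T h' z) := hh2
    rwa [hh1] at hh3
  · intro z hz
    refine le_trans (eCard_mono ?_) (hΦI.tempered _ (hQ (hrQ _ hz)) z)
    rintro h ⟨⟨hlt, hn⟩, g, hg, hg'⟩
    exact ⟨r (ℓ (T h z)), hQ (hrQ _ hn), hr _ _ hlt hn, g, hg, hg'⟩

/-- The weak type `(1, 1)` maximal inequality. -/
lemma mul_measure_lt_orbitMax_le (hT : IsMPAction T m) (hC0 : C ≠ 0) (hC : C ≠ ∞)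
    (hΦ : ∀ i g, MeasurableSet {z | g ∈ Φ i z}) {q : ℕ → ι}
    (hΦI : IsTemperedAction T Φ (Set.range q) C)
    {f : Z → ℝ≥0∞} (hf : Measurable f) (t : ℝ≥0∞) :
    t * m {z | t < orbitMax T Φ q f z} ≤ 2 * C * ∫⁻ z, f z ∂m := by
  classical
  have : {z | t < orbitMax T Φ q f z} =
      ⋃ n : ℕ, {z | ∃ i ∈ (Finset.range n).image q, t < orbitAvg T Φ f i z} := by
    ext z
    simp only [orbitMax, lt_iSup_iff, Set.mem_ofPred_eq, Set.mem_iUnion, Finset.mem_image,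
      Finset.mem_range]
    constructor
    · rintro ⟨n, hn⟩
      exact ⟨n + 1, q n, ⟨n, by omega, rfl⟩, hn⟩
    · rintro ⟨n, i, ⟨k, -, rfl⟩, hk⟩
      exact ⟨k, hk⟩
  rw [this, Monotone.measure_iUnion, ENNReal.mul_iSup]
  · refine iSup_le fun n => mul_measure_exists_lt_orbitAvg_le hT hC0 hC hΦ hΦI _ ?_ hf t
    intro i hi
    obtain ⟨k, -, rfl⟩ := Finset.mem_image.1 (Finset.mem_coe.1 hi)
    exact ⟨k, rfl⟩
  · rintro a b hab z ⟨i, hi, hit⟩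
    exact ⟨i, Finset.image_subset_image (Finset.range_mono hab) hi, hit⟩

/-- The part of `f` below height `t` contributes at most `t` to any average, so the weak type
inequality is needed only for the part above. This localised form is what both interpolation
arguments use. -/
lemma mul_measure_two_mul_lt_orbitMax_le (hT : IsMPAction T m) (hC0 : C ≠ 0) (hC : C ≠ ∞)
    (hΦ : ∀ i g, MeasurableSet {z | g ∈ Φ i z}) {q : ℕ → ι}
    (hΦI : IsTemperedAction T Φ (Set.range q) C)
    {f : Z → ℝ≥0∞} (hf : Measurable f) (t : ℝ≥0∞) :
    t * m {z | 2 * t < orbitMax T Φ q f z} ≤ 2 * C * ∫⁻ z in {z | t < f z}, f z ∂m := by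
  have hm : MeasurableSet {z | t < f z} := measurableSet_lt measurable_const hf
  rw [← lintegral_indicator hm]
  refine le_trans ?_ (mul_measure_lt_orbitMax_le hT hC0 hC hΦ hΦI (hf.indicator hm) t)
  gcongr 2
  intro z hz
  have hle : orbitMax T Φ q f z ≤ orbitMax T Φ q ({z | t < f z}.indicator f) z + t := by
    refine iSup_le fun n => ?_
    refine le_trans ?_ (add_le_add_left (le_iSup _ n) t)
    calc orbitAvg T Φ f (q n) z
        ≤ setAvg (Φ (q n) z) (fun g => {z | t < f z}.indicator f (T g z) + t) := by
          refine setAvg_mono fun g _ => ?_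
          by_cases h : t < f (T g z)
          · simp [h]
          · simpa [h] using not_lt.1 h
      _ ≤ orbitAvg T Φ ({z | t < f z}.indicator f) (q n) z + t := by
          rw [setAvg_add]
          exact add_le_add_right (setAvg_const_le t) _
  have h2 : t + t < orbitMax T Φ q ({z | t < f z}.indicator f) z + t := by
    rw [← two_mul]; exact lt_of_lt_of_le hz hle
  exact lt_of_add_lt_add_right h2

end Maximal

/-! ### From weak type to strong type inequalities -/

section Interpolation

variable {Z : Type*} [MeasurableSpace Z] {m : Measure Z}

/-- The layer cake formula concerns real-valued functions, so `M` is truncated at `k` and recovered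
by monotone convergence. The division by `2` matches the height `2 t` in the localised weak type
inequality. -/
lemma lintegral_le_of_forall_min_le {M : Z → ℝ≥0∞} (hM : Measurable M) {p : ℝ} (hp : 0 < p)
    {A : ℝ≥0∞} (h : ∀ k : ℕ, ∫⁻ z, ENNReal.ofReal (((min (M z) k).toReal / 2) ^ p) ∂m ≤ A) :
    ∫⁻ z, M z ^ p ∂m ≤ 2 ^ p * A := by
  have hsup : ∀ z, M z ^ p = ⨆ k : ℕ, (min (M z) k) ^ p := by
    intro z
    have h1 : Monotone fun x : ℝ≥0∞ => x ^ p := ENNReal.monotone_rpow_of_nonneg hp.le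
    have h2 : Tendsto (fun k : ℕ => min (M z) (k : ℝ≥0∞)) atTop (𝓝 (min (M z) ∞)) :=
      tendsto_const_nhds.min ENNReal.tendsto_nat_nhds_top
    rw [min_eq_left le_top] at h2
    have h3 := (ENNReal.continuous_rpow_const (y := p)).tendsto (M z) |>.comp h2
    exact tendsto_nhds_unique h3
      (tendsto_atTop_iSup fun a b hab => h1 (min_le_min le_rfl (by exact_mod_cast hab)))
  simp_rw [hsup]
  rw [lintegral_iSup]
  · refine iSup_le fun k => ?_
    calc ∫⁻ z, (min (M z) k) ^ p ∂m
        = ∫⁻ z, 2 ^ p * ENNReal.ofReal (((min (M z) k).toReal / 2) ^ p) ∂m := by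
          refine lintegral_congr fun z => ?_
          have hfin : min (M z) (k : ℝ≥0∞) ≠ ∞ :=
            ne_top_of_le_ne_top (ENNReal.natCast_ne_top k) (min_le_right _ _)
          rw [← ENNReal.ofReal_rpow_of_nonneg (by positivity) hp.le,
            ← ENNReal.mul_rpow_of_nonneg _ _ hp.le, ENNReal.ofReal_div_of_pos two_pos,
            ENNReal.ofReal_toReal hfin, ENNReal.ofReal_ofNat,
            ENNReal.mul_div_cancel two_ne_zero ENNReal.ofNat_ne_top]
      _ = 2 ^ p * ∫⁻ z, ENNReal.ofReal (((min (M z) k).toReal / 2) ^ p) ∂m :=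
          lintegral_const_mul _ (by fun_prop)
      _ ≤ 2 ^ p * A := by gcongr; exact h k
  · intro k; fun_prop
  · intro a b hab z
    exact ENNReal.monotone_rpow_of_nonneg hp.le (min_le_min le_rfl (by exact_mod_cast hab))

lemma measure_lt_min_le {M : Z → ℝ≥0∞} {f : Z → ℝ} {K : ℝ≥0∞}
    (hw : ∀ t : ℝ, 0 < t → ENNReal.ofReal t * m {z | 2 * ENNReal.ofReal t < M z} ≤
      K * ∫⁻ z in {z | t < f z}, ENNReal.ofReal (f z) ∂m) (k : ℕ) {t : ℝ} (ht : 0 < t) :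
    m {z | t < (min (M z) k).toReal / 2} ≤
      K * (ENNReal.ofReal t⁻¹ * ∫⁻ z in {z | t < f z}, ENNReal.ofReal (f z) ∂m) := by
  have hsub : {z | t < (min (M z) k).toReal / 2} ⊆ {z | 2 * ENNReal.ofReal t < M z} := by
    intro z hz
    have hz' : 2 * t < (min (M z) k).toReal := by
      have : t < (min (M z) k).toReal / 2 := hz
      linarith
    have h1 := (ENNReal.ofReal_lt_iff_lt_toReal (by positivity)
      (ne_top_of_le_ne_top (ENNReal.natCast_ne_top k) (min_le_right _ _))).2 hz'
    rw [ENNReal.ofReal_mul two_pos.le, ENNReal.ofReal_ofNat] at h1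
    exact h1.trans_le (min_le_left _ _)
  refine (measure_mono hsub).trans ?_
  have h0 : ENNReal.ofReal t ≠ 0 := by simpa using ht
  calc m {z | 2 * ENNReal.ofReal t < M z}
      = ENNReal.ofReal t⁻¹ * (ENNReal.ofReal t * m {z | 2 * ENNReal.ofReal t < M z}) := by
        rw [← mul_assoc, ENNReal.ofReal_inv_of_pos ht,
          ENNReal.inv_mul_cancel h0 ENNReal.ofReal_ne_top, one_mul]
    _ ≤ ENNReal.ofReal t⁻¹ * (K * ∫⁻ z in {z | t < f z}, ENNReal.ofReal (f z) ∂m) := by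
        exact mul_le_mul_right (hw t ht) _
    _ = _ := by ring

/-- Interpolation between weak type `(1, 1)` and `L^∞`. -/
lemma lintegral_rpow_le_of_weakType {M : Z → ℝ≥0∞} (hM : Measurable M) {f : Z → ℝ}
    (hf : Measurable f) (hf0 : ∀ z, 0 ≤ f z) {K : ℝ≥0∞}
    (hw : ∀ t : ℝ, 0 < t → ENNReal.ofReal t * m {z | 2 * ENNReal.ofReal t < M z} ≤
      K * ∫⁻ z in {z | t < f z}, ENNReal.ofReal (f z) ∂m) {p : ℝ} (hp : 1 < p) :
    ∫⁻ z, M z ^ p ∂m ≤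
      2 ^ p * (K * (ENNReal.ofReal (p / (p - 1)) * ∫⁻ z, ENNReal.ofReal (f z) ^ p ∂m)) := by
  have hp0 : 0 < p := by linarith
  have hp1 : 0 < p - 1 := by linarith
  refine lintegral_le_of_forall_min_le hM hp0 fun k => ?_
  rw [lintegral_rpow_eq_lintegral_meas_lt_mul m (ae_of_all _ fun z => by positivity)
    (by fun_prop) hp0]
  -- The integral of `f` over `{t < f}` is the mass of this set for the measure with density `f`. A
  -- second layer cake formula, for that measure and the exponent `p - 1`, replaces an interchange
  -- of integrals.
  have hcake := lintegral_rpow_eq_lintegral_meas_lt_mul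
    (m.withDensity fun z => ENNReal.ofReal (f z)) (ae_of_all _ hf0) hf.aemeasurable hp1
  have hleft : ∫⁻ z, ENNReal.ofReal (f z ^ (p - 1)) ∂(m.withDensity fun z => ENNReal.ofReal (f z))
      = ∫⁻ z, ENNReal.ofReal (f z) ^ p ∂m := by
    rw [lintegral_withDensity_eq_lintegral_mul _ (by fun_prop) (by fun_prop)]
    refine lintegral_congr fun z => ?_
    rw [Pi.mul_apply, ← ENNReal.ofReal_mul (hf0 z),
      ENNReal.ofReal_rpow_of_nonneg (hf0 z) hp0.le]
    rcases (hf0 z).eq_or_lt with h | h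
    · simp [← h, hp0.ne']
    · rw [Real.rpow_sub_one h.ne', mul_div_cancel₀ _ h.ne']
  rw [hleft] at hcake
  rw [hcake]
  calc ENNReal.ofReal p * ∫⁻ t in Set.Ioi 0, m {z | t < (min (M z) k).toReal / 2} *
        ENNReal.ofReal (t ^ (p - 1))
      ≤ ENNReal.ofReal p * ∫⁻ t in Set.Ioi 0, K *
        ((m.withDensity fun z => ENNReal.ofReal (f z)) {z | t < f z} *
          ENNReal.ofReal (t ^ (p - 1 - 1))) := by
        gcongr 1
        refine setLIntegral_mono' measurableSet_Ioi fun t ht => ?_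
        have ht : 0 < t := ht
        refine (mul_le_mul_left (measure_lt_min_le hw k ht) _).trans (le_of_eq ?_)
        rw [withDensity_apply _ (measurableSet_lt measurable_const hf), Real.rpow_sub_one ht.ne' (p - 1),
          div_eq_mul_inv (t ^ (p - 1)), ENNReal.ofReal_mul (by positivity)]
        ring
    _ = K * (ENNReal.ofReal (p / (p - 1)) * (ENNReal.ofReal (p - 1) *
          ∫⁻ t in Set.Ioi 0, (m.withDensity fun z => ENNReal.ofReal (f z)) {z | t < f z} *
          ENNReal.ofReal (t ^ (p - 1 - 1)))) := by
        rw [lintegral_const_mul]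
        · rw [← mul_assoc (ENNReal.ofReal (p / (p - 1))), ← ENNReal.ofReal_mul (by positivity),
            div_mul_cancel₀ _ hp1.ne']
          ring
        · refine Measurable.mul (Antitone.measurable fun a b hab => measure_mono ?_) (by fun_prop)
          intro z hz
          exact lt_of_le_of_lt hab hz

/-- Integrability of functions of weak type dominated by a function in `L log L`. -/
lemma lintegral_le_of_weakType {M : Z → ℝ≥0∞} (hM : Measurable M) {f : Z → ℝ}
    (hf : Measurable f) (hf0 : ∀ z, 0 ≤ f z) {K : ℝ≥0∞}
    (hw : ∀ t : ℝ, 0 < t → ENNReal.ofReal t * m {z | 2 * ENNReal.ofReal t < M z} ≤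
      K * ∫⁻ z in {z | t < f z}, ENNReal.ofReal (f z) ∂m) :
    ∫⁻ z, M z ∂m ≤
      2 * (m {z | M z ≠ 0} + K * ∫⁻ z, ENNReal.ofReal (f z * Real.posLog (f z)) ∂m) := by
  suffices h : ∫⁻ z, M z ^ (1 : ℝ) ∂m ≤ 2 ^ (1 : ℝ) *
      (m {z | M z ≠ 0} + K * ∫⁻ z, ENNReal.ofReal (f z * Real.posLog (f z)) ∂m) by
    simpa using h
  refine lintegral_le_of_forall_min_le hM one_pos fun k => ?_
  rw [lintegral_rpow_eq_lintegral_meas_lt_mul m (ae_of_all _ fun z => by positivity)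
    (by fun_prop) one_pos]
  -- Cutting `t⁻¹` off below `1`, where it is not integrable, makes its primitive `log⁺`. Heights `t
  -- ≤ 1` are bounded by the measure of `{M ≠ 0}` instead.
  set G : ℝ → ℝ := (Set.Ioi 1).indicator fun t => t⁻¹ with hG
  have hGm : Measurable G := measurable_inv.indicator measurableSet_Ioi
  have hG0 : ∀ t, 0 ≤ G t := fun t =>
    Set.indicator_nonneg (fun t (ht : 1 < t) => inv_nonneg.2 (zero_le_one.trans ht.le)) t
  have hG1 : ∀ t, G t ≤ 1 := fun t =>
    Set.indicator_apply_le' (fun ht : 1 < t => inv_le_one_of_one_le₀ ht.le) fun _ => zero_le_one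
  have hGint : ∀ a b, IntervalIntegrable G volume a b := fun a b =>
    (intervalIntegrable_const (c := (1 : ℝ))).mono_fun hGm.aestronglyMeasurable
      (ae_of_all _ fun t => by simpa [abs_of_nonneg (hG0 t)] using hG1 t)
  have hlog : ∀ x, 0 ≤ x → ∫ t in (0 : ℝ)..x, G t = Real.posLog x := by
    intro x hx
    rcases le_total x 1 with h | h
    · rw [Real.posLog_eq_zero_iff _ |>.2 (by rwa [abs_of_nonneg hx]),
        intervalIntegral.integral_of_le hx]
      refine setIntegral_eq_zero_of_forall_eq_zero fun t ht => ?_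
      exact Set.indicator_of_notMem (not_lt.2 (ht.2.trans h)) _
    · rw [Real.posLog_eq_log (by rwa [abs_of_nonneg hx]),
        ← intervalIntegral.integral_add_adjacent_intervals (hGint 0 1) (hGint 1 x)]
      have h1 : ∫ t in (0 : ℝ)..1, G t = 0 := by
        rw [intervalIntegral.integral_of_le zero_le_one]
        refine setIntegral_eq_zero_of_forall_eq_zero fun t ht => ?_
        exact Set.indicator_of_notMem (not_lt.2 ht.2) _
      have h2 : ∫ t in (1 : ℝ)..x, G t = Real.log x := by
        have : ∫ t in (1 : ℝ)..x, G t = ∫ t in (1 : ℝ)..x, t⁻¹ := by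
          rw [intervalIntegral.integral_of_le h, intervalIntegral.integral_of_le h]
          refine setIntegral_congr_fun measurableSet_Ioc fun t ht => ?_
          exact Set.indicator_of_mem (show t ∈ Set.Ioi 1 from ht.1) _
        rw [this, integral_inv_of_pos one_pos (by linarith), div_one]
      rw [h1, h2, zero_add]
  have hcake := lintegral_comp_eq_lintegral_meas_lt_mul
    (m.withDensity fun z => ENNReal.ofReal (f z)) (ae_of_all _ hf0) hf.aemeasurable
    (fun t _ => hGint 0 t) (ae_of_all _ hG0)
  have hposLog : Measurable Real.posLog := by
    unfold Real.posLog; fun_prop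
  have hleft : ∫⁻ z, ENNReal.ofReal (∫ t in (0 : ℝ)..f z, G t)
        ∂(m.withDensity fun z => ENNReal.ofReal (f z))
      = ∫⁻ z, ENNReal.ofReal (f z * Real.posLog (f z)) ∂m := by
    simp_rw [fun z => hlog (f z) (hf0 z)]
    rw [lintegral_withDensity_eq_lintegral_mul _ (by fun_prop) (by fun_prop)]
    refine lintegral_congr fun z => ?_
    rw [Pi.mul_apply, ← ENNReal.ofReal_mul (hf0 z)]
  rw [hleft] at hcake
  rw [hcake, ENNReal.ofReal_one, one_mul]
  calc ∫⁻ t in Set.Ioi 0, m {z | t < (min (M z) k).toReal / 2} * ENNReal.ofReal (t ^ ((1 : ℝ) - 1))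
      ≤ ∫⁻ t in Set.Ioi 0, ((Set.Ioc 0 1).indicator (fun _ => m {z | M z ≠ 0}) t + K *
        ((m.withDensity fun z => ENNReal.ofReal (f z)) {z | t < f z} *
          ENNReal.ofReal (G t))) := by
        refine setLIntegral_mono' measurableSet_Ioi fun t ht => ?_
        have ht : 0 < t := ht
        rw [sub_self, Real.rpow_zero, ENNReal.ofReal_one, mul_one]
        rcases le_or_gt t 1 with h | h
        · refine le_add_right ?_
          rw [Set.indicator_of_mem (show t ∈ Set.Ioc 0 1 from ⟨ht, h⟩)]
          refine measure_mono fun z hz h0 => ?_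
          have hz : t < (min (M z) k).toReal / 2 := hz
          rw [h0] at hz
          simp at hz
          linarith
        · refine le_add_left ((measure_lt_min_le hw k ht).trans (le_of_eq ?_))
          rw [withDensity_apply _ (measurableSet_lt measurable_const hf), hG,
            Set.indicator_of_mem (show t ∈ Set.Ioi 1 from h), mul_comm (ENNReal.ofReal _)]
    _ = m {z | M z ≠ 0} + K * ∫⁻ t in Set.Ioi 0,
          (m.withDensity fun z => ENNReal.ofReal (f z)) {z | t < f z} *
          ENNReal.ofReal (G t) := by
        rw [lintegral_add_left (measurable_const.indicator measurableSet_Ioc),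
          lintegral_indicator measurableSet_Ioc, lintegral_const_mul]
        · congr 1
          rw [setLIntegral_const, Measure.restrict_apply measurableSet_Ioc,
            Set.inter_eq_left.2 (fun t ht => ht.1)]
          simp
        · refine Measurable.mul (Antitone.measurable fun a b hab => measure_mono ?_) (by fun_prop)
          intro z hz
          exact lt_of_le_of_lt hab hz

end Interpolation

/-! ### A countable family that is dense in measure -/

/-- A family of measurable functions with countably many values contains a sequence which is dense
for almost everywhere eventual equality of subsequences. -/
lemma exists_seq_ae_eventually_eq {Y ι α : Type*} [MeasurableSpace Y]
    [MeasurableSpace.CountablyGenerated Y] [Nonempty ι] [Countable α]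
    (m : Measure Y) [IsFiniteMeasure m] (c : ι → Y → α)
    (hc : ∀ i a, MeasurableSet {y | c i y = a}) :
    ∃ q : ℕ → ι, ∀ i, ∃ k : ℕ → ℕ, ∀ᵐ y ∂m, ∀ᶠ j in atTop, c (q (k j)) y = c i y := by
  obtain ⟨e, he⟩ := exists_injective_nat α
  -- A bounded injective encoding of the values places the family in `L¹(m)`, which is separable
  -- because the σ-algebra is countably generated.
  set u : ι → Y → ℝ := fun i y => ((e (c i y) : ℝ) + 1)⁻¹ with hu
  have hum : ∀ i, Measurable (u i) := by
    intro i
    have : Measurable fun y => e (c i y) := by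
      refine measurable_to_countable' fun n => ?_
      by_cases hn : ∃ a, e a = n
      · obtain ⟨a, rfl⟩ := hn
        convert hc i a using 1
        ext y
        simp [he.eq_iff]
      · convert MeasurableSet.empty using 1
        ext y
        simp only [Set.mem_preimage, Set.mem_singleton_iff, Set.mem_empty_iff_false, iff_false]
        exact fun h => hn ⟨_, h⟩
    exact ((measurable_from_nat.comp this).add_const 1).inv
  have hub : ∀ i y, ‖u i y‖ ≤ 1 := by
    intro i y
    have : (0 : ℝ) ≤ e (c i y) := Nat.cast_nonneg _
    rw [hu, Real.norm_of_nonneg (by positivity)]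
    exact inv_le_one_of_one_le₀ (by linarith)
  have huL : ∀ i, MemLp (u i) 1 m := fun i =>
    MemLp.of_bound (hum i).aestronglyMeasurable 1 (ae_of_all _ (hub i))
  set v : ι → Lp ℝ 1 m := fun i => (huL i).toLp (u i) with hv
  have : Fact ((1 : ℝ≥0∞) ≠ ∞) := ⟨ENNReal.one_ne_top⟩
  -- Density is taken inside the range, so that the dense sequence comes from actual indices.
  obtain ⟨s, hs⟩ := TopologicalSpace.exists_dense_seq (Set.range v)
  choose q hq using fun n => (s n).2
  refine ⟨q, fun i => ?_⟩
  have hmem : (⟨v i, i, rfl⟩ : Set.range v) ∈ closure (Set.range s) := hs _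
  obtain ⟨x, hx, hlim⟩ := mem_closure_iff_seq_limit.1 hmem
  choose k hk using hx
  have hlim' : Tendsto (fun j => v (q (k j))) atTop (𝓝 (v i)) := by
    have := (continuous_subtype_val.tendsto _).comp hlim
    refine this.congr fun j => ?_
    rw [Function.comp_apply, ← hk j, hq]
  obtain ⟨ns, -, hns⟩ := (tendstoInMeasure_of_tendsto_Lp hlim').exists_seq_tendsto_ae
  refine ⟨fun j => k (ns j), ?_⟩
  have hco : ∀ᵐ y ∂m, ∀ i', i' = i ∨ i' ∈ Set.range q → (v i' : Y → ℝ) y = u i' y := by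
    have hcount : (insert i (Set.range q)).Countable := (Set.countable_range q).insert i
    have := (ae_ball_iff hcount).2 fun i' _ => (huL i').coeFn_toLp
    filter_upwards [this] with y hy i' hi'
    exact hy i' (by simpa using hi')
  filter_upwards [hns, hco] with y hy hyc
  rw [hyc i (Or.inl rfl)] at hy
  have hy' : Tendsto (fun j => u (q (k (ns j))) y) atTop (𝓝 (u i y)) :=
    hy.congr fun j => hyc _ (Or.inr ⟨_, rfl⟩)
  have hpos : (0 : ℝ) < (e (c i y) : ℝ) + 1 := by positivity
  have hinv := hy'.inv₀ (inv_ne_zero hpos.ne')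
  simp only [hu, inv_inv] at hinv
  -- Inverting the encoding gives convergence of natural numbers, which is eventual equality.
  have hnat : Tendsto (fun j => e (c (q (k (ns j))) y)) atTop (𝓝 (e (c i y))) := by
    rw [Nat.isClosedEmbedding_coe_real.isInducing.tendsto_nhds_iff]
    simpa [Function.comp_def] using hinv.sub_const 1
  rw [nhds_discrete, tendsto_pure] at hnat
  exact hnat.mono fun j hj => he hj

/-! ### The measure on the finite factor -/

lemma thetaI_singleton_pos {lam : ℝ} (hlam : 0 < lam) (N : ℕ) (t : Fin N) :
    thetaI lam N {t} ≠ 0 := by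
  have : Nonempty (Fin N) := ⟨t⟩
  have hs : 0 < ∑ k : Fin N, lam⁻¹ ^ (k : ℕ) :=
    Finset.sum_pos (fun k _ => by positivity) Finset.univ_nonempty
  rw [thetaI, Measure.finsetSum_apply]
  refine ne_of_gt (lt_of_lt_of_le ?_ (Finset.single_le_sum (fun _ _ => zero_le) (Finset.mem_univ t)))
  simp only [Measure.smul_apply, Measure.dirac_apply_of_mem (Set.mem_singleton t), smul_eq_mul,
    mul_one, ENNReal.ofReal_pos]
  positivity

instance isFiniteMeasure_thetaI (lam : ℝ) (N : ℕ) : IsFiniteMeasure (thetaI lam N) := by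
  refine ⟨?_⟩
  rw [thetaI, Measure.finsetSum_apply]
  simp [ENNReal.sum_lt_top, ENNReal.ofReal_lt_top]

lemma forall_of_ae_thetaI {lam : ℝ} (hlam : 0 < lam) {N : ℕ} {p : Fin N → Prop}
    (hp : ∀ᵐ t ∂thetaI lam N, p t) (t : Fin N) : p t := by
  by_contra h
  refine thetaI_singleton_pos hlam N t (measure_mono_null ?_ hp)
  rintro s rfl
  exact h

lemma ae_forall_of_ae_prod_thetaI {B : Type*} [MeasurableSpace B] {ν : Measure B} [SFinite ν]
    {lam : ℝ} (hlam : 0 < lam) {N : ℕ} {p : B × Fin N → Prop}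
    (hp : ∀ᵐ y ∂ν.prod (thetaI lam N), p y) : ∀ᵐ b ∂ν, ∀ t, p (b, t) :=
  (Measure.ae_ae_of_ae_prod hp).mono fun _ h => forall_of_ae_thetaI hlam h

/-! ### The Radon-Nikodym cocycle -/

section Cocycle

variable {Γ B : Type*} [Group Γ] [MeasurableSpace B] [MulAction Γ B] {ν : Measure B}
  {lam : ℝ} {R : Γ → B → ℤ}

/-- The push-forward under `g⁻¹` is `ν ∘ g`. It is equivalent to `ν`, so the derivative is almost
everywhere positive and finite, and the default values of `Real.logb` at `0` and of `toReal` at `∞`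
play no role. -/
lemma ae_rnDeriv_eq_zpow [MeasurableConstSMul Γ B] [IsProbabilityMeasure ν]
    (hν : ∀ g : Γ, Measure.QuasiMeasurePreserving (fun b : B => g • b) ν ν)
    (hlam0 : 0 < lam) (hlam1 : lam < 1)
    (hR : ∀ g, ∀ᵐ b ∂ν, (R g b : ℝ) = logRN ν lam g b) (g : Γ) :
    ∀ᵐ b ∂ν, (ν.map fun b' => g⁻¹ • b').rnDeriv ν b = ENNReal.ofReal (lam ^ R g b) := by
  have : IsProbabilityMeasure (ν.map fun b' => g⁻¹ • b') :=
    Measure.isProbabilityMeasure_map (measurable_const_smul _).aemeasurable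
  have hac : ν ≪ ν.map fun b' => g⁻¹ • b' := by
    refine Measure.AbsolutelyContinuous.mk fun A hA h0 => ?_
    rw [Measure.map_apply (measurable_const_smul _) hA] at h0
    have := (hν g).preimage_null h0
    rw [← Set.preimage_comp] at this
    simpa [Function.comp_def] using this
  filter_upwards [hR g, Measure.rnDeriv_pos' hac, Measure.rnDeriv_lt_top (ν.map fun b' => g⁻¹ • b') ν]
    with b h1 h2 h3
  rw [← Real.rpow_intCast, h1, logRN, Real.rpow_logb hlam0 hlam1.ne
    (ENNReal.toReal_pos h2.ne' h3.ne), ENNReal.ofReal_toReal h3.ne]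

lemma lintegral_eq_lintegral_smul_mul_zpow [MeasurableConstSMul Γ B] [IsProbabilityMeasure ν]
    (hν : ∀ g : Γ, Measure.QuasiMeasurePreserving (fun b : B => g • b) ν ν)
    (hlam0 : 0 < lam) (hlam1 : lam < 1)
    (hR : ∀ g, ∀ᵐ b ∂ν, (R g b : ℝ) = logRN ν lam g b) (g : Γ)
    {u : B → ℝ≥0∞} (hu : Measurable u) :
    ∫⁻ b, u b ∂ν = ∫⁻ b, ENNReal.ofReal (lam ^ R g b) * u (g • b) ∂ν := by
  have : IsProbabilityMeasure (ν.map fun b' => g⁻¹ • b') :=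
    Measure.isProbabilityMeasure_map (measurable_const_smul _).aemeasurable
  have hu' : Measurable fun b => u (g • b) := hu.comp (measurable_const_smul g)
  calc ∫⁻ b, u b ∂ν = ∫⁻ b, u (g • b) ∂(ν.map fun b' => g⁻¹ • b') := by
        rw [lintegral_map hu' (measurable_const_smul _)]
        simp
    _ = ∫⁻ b, (ν.map fun b' => g⁻¹ • b').rnDeriv ν b * u (g • b) ∂ν :=
        (lintegral_rnDeriv_mul (hν g⁻¹).absolutelyContinuous hu'.aemeasurable).symm
    _ = _ := by
        refine lintegral_congr_ae ?_
        filter_upwards [ae_rnDeriv_eq_zpow hν hlam0 hlam1 hR g] with b hb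
        rw [hb]

/-- This is the chain rule. Changing variables by `g * h` at once, or by `g` and then by `h`, gives
equal integrals of translated indicators, and `lam ^ n` determines `n`. -/
lemma ae_cocycle [MeasurableConstSMul Γ B] [IsProbabilityMeasure ν]
    (hν : ∀ g : Γ, Measure.QuasiMeasurePreserving (fun b : B => g • b) ν ν)
    (hlam0 : 0 < lam) (hlam1 : lam < 1) (hRmeas : ∀ g, Measurable (R g))
    (hR : ∀ g, ∀ᵐ b ∂ν, (R g b : ℝ) = logRN ν lam g b) (g h : Γ) :
    ∀ᵐ b ∂ν, R (g * h) b = R g (h • b) + R h b := by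
  have hκ : ∀ g : Γ, Measurable fun b => ENNReal.ofReal (lam ^ R g b) := fun g =>
    ENNReal.measurable_ofReal.comp ((measurable_of_countable fun n : ℤ => lam ^ n).comp (hRmeas g))
  have hκ' : Measurable fun b => ENNReal.ofReal (lam ^ R h b) * ENNReal.ofReal (lam ^ R g (h • b)) :=
    (hκ h).mul ((hκ g).comp (measurable_const_smul h))
  have key : (fun b => ENNReal.ofReal (lam ^ R (g * h) b)) =ᵐ[ν]
      fun b => ENNReal.ofReal (lam ^ R h b) * ENNReal.ofReal (lam ^ R g (h • b)) := by
    refine ae_eq_of_forall_setLIntegral_eq_of_sigmaFinite (hκ _) hκ' fun A hA _ => ?_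
    set u : B → ℝ≥0∞ := fun b => A.indicator (fun _ => 1) ((g * h)⁻¹ • b) with hu
    have hum : Measurable u :=
      (measurable_const.indicator hA).comp (measurable_const_smul (g * h)⁻¹)
    have e1 := lintegral_eq_lintegral_smul_mul_zpow hν hlam0 hlam1 hR (g * h) hum
    have e2 := lintegral_eq_lintegral_smul_mul_zpow hν hlam0 hlam1 hR g hum
    have e3 := lintegral_eq_lintegral_smul_mul_zpow hν hlam0 hlam1 hR h
      (u := fun b => ENNReal.ofReal (lam ^ R g b) * u (g • b))
      ((hκ g).mul (hum.comp (measurable_const_smul g)))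
    rw [e1, e3] at e2
    rw [← lintegral_indicator hA, ← lintegral_indicator hA]
    convert e2 using 2
    · ext b
      by_cases hb : b ∈ A <;> simp only [hu, inv_smul_smul, hb, Set.indicator_of_mem,
        Set.indicator_of_notMem, not_false_eq_true, mul_one, mul_zero]
    · ext b
      by_cases hb : b ∈ A <;> simp only [hu, ← mul_smul g h, inv_smul_smul, hb,
        Set.indicator_of_mem, Set.indicator_of_notMem, not_false_eq_true, mul_one, mul_zero]
  filter_upwards [key] with b hb
  rw [← ENNReal.ofReal_mul (by positivity), ← zpow_add₀ hlam0.ne',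
    ENNReal.ofReal_eq_ofReal_iff (by positivity) (by positivity)] at hb
  have := zpow_right_injective₀ hlam0 hlam1.ne hb
  omega

/-- A measurable conull invariant set on which the action is free and `R` is a cocycle. -/
structure IsGoodSet (ν : Measure B) (R : Γ → B → ℤ) (B₀ : Set B) : Prop where
  measurableSet : MeasurableSet B₀
  ae_mem : ∀ᵐ b ∂ν, b ∈ B₀
  smul_mem : ∀ (g : Γ), ∀ b ∈ B₀, g • b ∈ B₀
  free : ∀ b ∈ B₀, ∀ g : Γ, g • b = b → g = 1
  cocycle : ∀ b ∈ B₀, ∀ g h : Γ, R (g * h) b = R g (h • b) + R h b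

/-- Intersecting the countably many translates of a measurable conull set gives an invariant one,
still conull because `Γ` preserves null sets. The extra property `p` then holds along whole orbits,
which lets almost everywhere hypotheses on the family be used pointwise. -/
lemma exists_isGoodSet [Countable Γ] [MeasurableConstSMul Γ B] [IsProbabilityMeasure ν]
    (hν : ∀ g : Γ, Measure.QuasiMeasurePreserving (fun b : B => g • b) ν ν)
    (hfree : ∀ᵐ b ∂ν, ∀ g : Γ, g • b = b → g = 1)
    (hcoc : ∀ g h, ∀ᵐ b ∂ν, R (g * h) b = R g (h • b) + R h b)
    {p : B → Prop} (hp : ∀ᵐ b ∂ν, p b) :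
    ∃ B₀, IsGoodSet ν R B₀ ∧ ∀ b ∈ B₀, p b := by
  have hall : ∀ᵐ b ∂ν, p b ∧ (∀ g : Γ, g • b = b → g = 1) ∧
      ∀ g h, R (g * h) b = R g (h • b) + R h b :=
    hp.and (hfree.and (ae_all_iff.2 fun g => ae_all_iff.2 fun h => hcoc g h))
  obtain ⟨s, hs, hsm, hs'⟩ := hall.exists_measurable_mem
  have hsub : ∀ b ∈ ⋂ g : Γ, (fun b => g • b) ⁻¹' s, b ∈ s := fun b hb => by
    simpa using Set.mem_iInter.1 hb 1
  refine ⟨⋂ g : Γ, (fun b => g • b) ⁻¹' s, ⟨?_, ?_, ?_, ?_, ?_⟩, ?_⟩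
  · exact MeasurableSet.iInter fun g => measurable_const_smul g hsm
  · simp only [Set.mem_iInter, Set.mem_preimage]
    exact ae_all_iff.2 fun g => (hν g).ae hs
  · intro g b hb
    simp only [Set.mem_iInter, Set.mem_preimage, ← mul_smul] at hb ⊢
    exact fun g' => hb _
  · exact fun b hb => (hs' b (hsub b hb)).2.1
  · exact fun b hb => (hs' b (hsub b hb)).2.2
  · exact fun b hb => (hs' b (hsub b hb)).1

variable {B₀ : Set B}

lemma IsGoodSet.smul_mem_iff (h : IsGoodSet ν R B₀) {g : Γ} {b : B} : g • b ∈ B₀ ↔ b ∈ B₀ :=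
  ⟨fun hb => by simpa using h.smul_mem g⁻¹ _ hb, h.smul_mem g b⟩

lemma IsGoodSet.smul_injective (h : IsGoodSet ν R B₀) {b : B} (hb : b ∈ B₀) :
    Function.Injective fun g : Γ => g • b := by
  intro g g' hg
  have : (g'⁻¹ * g) • b = b := by
    rw [mul_smul]
    simp only at hg
    rw [hg, inv_smul_smul]
  exact (inv_mul_eq_one.1 (h.free b hb _ this)).symm

lemma IsGoodSet.cocycle_one (h : IsGoodSet ν R B₀) {b : B} (hb : b ∈ B₀) : R 1 b = 0 := by
  have := h.cocycle b hb 1 1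
  simp at this
  exact this

end Cocycle

/-- The equivalence relation generated by maps which form an action on an invariant set `A`
is the orbit relation on `A`. -/
lemma eqvGen_exists_eq {Γ W : Type*} [Group Γ] {G : Γ → W → W} {A : Set W}
    (hA : ∀ g y, G g y ∈ A ↔ y ∈ A) (h1 : ∀ y ∈ A, G 1 y = y)
    (hmul : ∀ y ∈ A, ∀ g h, G (g * h) y = G g (G h y)) {y z : W}
    (h : Relation.EqvGen (fun y z => ∃ g, z = G g y) y z) :
    (y ∈ A ↔ z ∈ A) ∧ (y ∈ A → ∃ g, z = G g y) := by
  induction h with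
  | rel y z h =>
    obtain ⟨g, rfl⟩ := h
    exact ⟨(hA g y).symm, fun _ => ⟨g, rfl⟩⟩
  | refl y => exact ⟨Iff.rfl, fun hy => ⟨1, (h1 y hy).symm⟩⟩
  | symm y z _ ih =>
    refine ⟨ih.1.symm, fun hz => ?_⟩
    have hy := ih.1.2 hz
    obtain ⟨g, rfl⟩ := ih.2 hy
    exact ⟨g⁻¹, by rw [← hmul y hy, inv_mul_cancel, h1 y hy]⟩
  | trans x y z _ _ ih1 ih2 =>
    refine ⟨ih1.1.trans ih2.1, fun hx => ?_⟩
    obtain ⟨g, rfl⟩ := ih1.2 hx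
    obtain ⟨g', rfl⟩ := ih2.2 (ih1.1.1 hx)
    exact ⟨g' * g, (hmul x hx _ _).symm⟩

/-! ### Return sets of subset functions of the Maharam extension -/

section ReturnSet

variable {Γ B : Type*} [Group Γ] [MeasurableSpace B] [MulAction Γ B] {ν : Measure B}
  {R : Γ → B → ℤ} {N : ℕ} {B₀ : Set B}

lemma IsGoodSet.exists_of_maharamRelI (h : IsGoodSet ν R B₀) {b b' : B} {t t' : Fin N}
    (hb : b ∈ B₀) (hrel : maharamRelI R N (b, t) (b', t')) :
    ∃ g : Γ, b' = g • b ∧ ((t' : ℕ) : ℤ) = ((t : ℕ) : ℤ) + R g b := by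
  have := eqvGen_exists_eq (G := fun (g : Γ) (y : B × ℤ) => (g • y.1, y.2 + R g y.1))
    (A := {y | y.1 ∈ B₀}) (fun g y => h.smul_mem_iff)
    (fun y hy => by simp [h.cocycle_one hy])
    (fun y hy g g' => by
      simp only [Prod.mk.injEq]
      exact ⟨mul_smul _ _ _, by rw [h.cocycle _ hy]; ring⟩) hrel
  obtain ⟨g, hg⟩ := this.2 hb
  exact ⟨g, congrArg Prod.fst hg, congrArg Prod.snd hg⟩

/-- The elements of the group moving `(b, n)` into `U (b, n)`. -/
def returnSet (R : Γ → B → ℤ) (B₀ : Set B) (U : B × Fin N → Set (B × Fin N)) (y : B × ℤ) :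
    Set Γ :=
  {g | y.1 ∈ B₀ ∧ ∃ t t' : Fin N, ((t : ℕ) : ℤ) = y.2 ∧ ((t' : ℕ) : ℤ) = y.2 + R g y.1 ∧
    (g • y.1, t') ∈ U (y.1, t)}

omit [MeasurableSpace B] in
lemma mem_returnSet {U : B × Fin N → Set (B × Fin N)} {b : B} {t : Fin N} {g : Γ} (hb : b ∈ B₀) :
    g ∈ returnSet R B₀ U (b, ((t : ℕ) : ℤ)) ↔
      ∃ t' : Fin N, ((t' : ℕ) : ℤ) = ((t : ℕ) : ℤ) + R g b ∧ (g • b, t') ∈ U (b, t) := by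
  constructor
  · rintro ⟨-, s, t', hs, ht', hU⟩
    have : s = t := by
      simp only at hs
      ext; exact_mod_cast hs
    subst this
    exact ⟨t', ht', hU⟩
  · rintro ⟨t', ht', hU⟩
    exact ⟨hb, t, t', rfl, ht', hU⟩

lemma measurableSet_returnSet [MeasurableConstSMul Γ B] (hB₀ : MeasurableSet B₀)
    (hR : ∀ g, Measurable (R g)) {U : B × Fin N → Set (B × Fin N)}
    (hU : MeasurableSet {z : (B × Fin N) × (B × Fin N) | z.2 ∈ U z.1}) (g : Γ) :
    MeasurableSet {y | g ∈ returnSet R B₀ U y} := by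
  have : {y | g ∈ returnSet R B₀ U y} = {y : B × ℤ | y.1 ∈ B₀} ∩ ⋃ t : Fin N, ⋃ t' : Fin N,
      ({y : B × ℤ | y.2 = ((t : ℕ) : ℤ)} ∩ ({y : B × ℤ | y.2 + R g y.1 = ((t' : ℕ) : ℤ)} ∩
        (fun y : B × ℤ => ((y.1, t), (g • y.1, t'))) ⁻¹' {z | z.2 ∈ U z.1})) := by
    ext y
    simp [returnSet, eq_comm]
  rw [this]
  refine (measurable_fst hB₀).inter (MeasurableSet.iUnion fun t => MeasurableSet.iUnion fun t' => ?_)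
  refine (measurable_snd (measurableSet_singleton _)).inter (MeasurableSet.inter ?_ ?_)
  · exact (measurable_snd.add ((hR g).comp measurable_fst)) (measurableSet_singleton _)
  · refine Measurable.comp (g := fun z => z) measurable_id ?_ hU
    exact (measurable_fst.prodMk measurable_const).prodMk
      ((measurable_fst.const_smul g).prodMk measurable_const)

/-- Over `B₀` the generated relation is the orbit relation, so each point of `U (b, t)` is reached
by a group element. By freeness this element is unique, so passing to return sets loses neither
cardinalities nor the sets themselves. -/
lemma IsGoodSet.image_returnSet (h : IsGoodSet ν R B₀) {U : B × Fin N → Set (B × Fin N)}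
    (hU : ∀ x, ∀ y ∈ U x, maharamRelI R N x y) {b : B} (hb : b ∈ B₀) (t : Fin N) :
    (fun g : Γ => (g • b, ((t : ℕ) : ℤ) + R g b)) '' returnSet R B₀ U (b, ((t : ℕ) : ℤ)) =
      (fun y : B × Fin N => (y.1, ((y.2 : ℕ) : ℤ))) '' U (b, t) := by
  ext ⟨b', n⟩
  constructor
  · rintro ⟨g, hg, hgn⟩
    obtain ⟨t', ht', hU'⟩ := (mem_returnSet hb).1 hg
    refine ⟨_, hU', ?_⟩
    rw [← hgn]
    simp [ht']
  · rintro ⟨⟨b'', t'⟩, hU', hgn⟩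
    obtain ⟨g, rfl, hg⟩ := h.exists_of_maharamRelI hb (hU _ _ hU')
    refine ⟨g, (mem_returnSet hb).2 ⟨t', hg, hU'⟩, ?_⟩
    rw [← hgn]
    simp [hg]

omit [MeasurableSpace B] in
lemma injective_prod_fin_cast : Function.Injective
    (fun y : B × Fin N => ((y.1, ((y.2 : ℕ) : ℤ)) : B × ℤ)) := by
  rintro ⟨b, t⟩ ⟨b', t'⟩ h
  simp only [Prod.mk.injEq, Nat.cast_inj] at h
  exact Prod.ext h.1 (Fin.ext h.2)

lemma IsGoodSet.injective_orbit (h : IsGoodSet ν R B₀) {b : B} (hb : b ∈ B₀) (n : ℤ) :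
    Function.Injective (fun g : Γ => (g • b, n + R g b)) :=
  fun _ _ hg => h.smul_injective hb (congrArg Prod.fst hg)

lemma IsGoodSet.eCard_returnSet (h : IsGoodSet ν R B₀) {U : B × Fin N → Set (B × Fin N)}
    (hU : ∀ x, ∀ y ∈ U x, maharamRelI R N x y) {b : B} (hb : b ∈ B₀) (t : Fin N) :
    eCard (returnSet R B₀ U (b, ((t : ℕ) : ℤ))) = eCard (U (b, t)) := by
  rw [← eCard_image (h.injective_orbit hb _).injOn, h.image_returnSet hU hb,
    eCard_image injective_prod_fin_cast.injOn]

lemma IsGoodSet.finite_returnSet (h : IsGoodSet ν R B₀) {U : B × Fin N → Set (B × Fin N)}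
    (hU : ∀ x, ∀ y ∈ U x, maharamRelI R N x y) (hfin : ∀ x, (U x).Finite) (y : B × ℤ) :
    (returnSet R B₀ U y).Finite := by
  by_cases hne : (returnSet R B₀ U y).Nonempty
  · obtain ⟨g, hb, t, t', ht, -⟩ := hne
    obtain ⟨b, n⟩ := y
    simp only at hb ht
    subst ht
    refine Set.Finite.of_finite_image ?_ (h.injective_orbit hb ((t : ℕ) : ℤ)).injOn
    rw [h.image_returnSet hU hb]
    exact (hfin _).image _
  · rw [Set.not_nonempty_iff_eq_empty.1 hne]
    exact Set.finite_empty

lemma IsGoodSet.eq_of_returnSet_eq (h : IsGoodSet ν R B₀) {U V : B × Fin N → Set (B × Fin N)}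
    (hU : ∀ x, ∀ y ∈ U x, maharamRelI R N x y) (hV : ∀ x, ∀ y ∈ V x, maharamRelI R N x y)
    {b : B} (hb : b ∈ B₀) {t : Fin N}
    (heq : returnSet R B₀ U (b, ((t : ℕ) : ℤ)) = returnSet R B₀ V (b, ((t : ℕ) : ℤ))) :
    U (b, t) = V (b, t) := by
  have := h.image_returnSet hU hb t
  rw [heq, h.image_returnSet hV hb t] at this
  exact ((Set.image_injective.2 injective_prod_fin_cast) this).symm

lemma IsGoodSet.cocycle_inv (h : IsGoodSet ν R B₀) {b : B} (hb : b ∈ B₀) (g : Γ) :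
    R g⁻¹ (g • b) = - R g b := by
  have := h.cocycle b hb g⁻¹ g
  rw [inv_mul_cancel, h.cocycle_one hb] at this
  omega

/-- The elements `h` for which `U (h • (b, n))` contains a given point of the orbit of `(b, n)`. -/
lemma IsGoodSet.mem_subsetInv_of_mul_inv_mem (h : IsGoodSet ν R B₀)
    {U : B × Fin N → Set (B × Fin N)} {b : B} {n : ℤ} (hb : b ∈ B₀) {g k : Γ}
    (hk : g * k⁻¹ ∈ returnSet R B₀ U (k • b, n + R k b)) {u : Fin N}
    (hu : ((u : ℕ) : ℤ) = n + R g b) :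
    ∃ s : Fin N, ((s : ℕ) : ℤ) = n + R k b ∧ (k • b, s) ∈ subsetInv U (g • b, u) := by
  obtain ⟨-, s, s', hs, hs', hU⟩ := hk
  refine ⟨s, hs, ?_⟩
  -- The cocycle identity gives `R (g * k⁻¹) (k • b) = R g b - R k b`, so `g * k⁻¹` moves `(k • b, n
  -- + R k b)` to `(g • b, n + R g b)`, at height `u`.
  have h1 := h.cocycle (k • b) (h.smul_mem k b hb) g k⁻¹
  rw [inv_smul_smul, h.cocycle_inv hb] at h1
  have h2 : s' = u := by
    ext
    simp only at hs'
    rw [h1] at hs'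
    have : ((s' : ℕ) : ℤ) = ((u : ℕ) : ℤ) := by rw [hs', hu]; ring
    exact_mod_cast this
  simp only [mul_smul, inv_smul_smul, h2] at hU
  exact hU

/-- By freeness, the elements `k'` counted here embed in `subsetInv U` of the point `(b, n)`, which
lies in the set attached to `k • (b, n)`. -/
lemma IsGoodSet.incidence_returnSet (h : IsGoodSet ν R B₀) {C : ℝ≥0∞}
    {U : B × Fin N → Set (B × Fin N)} (hU : ∀ x, ∀ y ∈ U x, maharamRelI R N x y)
    (hC : ∀ b ∈ B₀, ∀ t, ∀ z ∈ U (b, t), eCard (subsetInv U z) ≤ C * eCard (U (b, t)))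
    {b : B} {n : ℤ} (hb : b ∈ B₀) {k : Γ}
    (hk : k⁻¹ ∈ returnSet R B₀ U (k • b, n + R k b)) :
    eCard {k' : Γ | k'⁻¹ ∈ returnSet R B₀ U (k' • b, n + R k' b)} ≤
      C * eCard (returnSet R B₀ U (k • b, n + R k b)) := by
  obtain ⟨-, t, u, ht, hu, hmem⟩ := id hk
  simp only [h.cocycle_inv hb, inv_smul_smul] at ht hu hmem
  rw [← ht, h.eCard_returnSet hU (h.smul_mem k b hb)]
  refine le_trans ?_ (hC _ (h.smul_mem k b hb) t _ hmem)
  rw [← eCard_image (h.injective_orbit hb n).injOn,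
    ← eCard_image (injective_prod_fin_cast (B := B) (N := N)).injOn]
  refine eCard_mono ?_
  rintro - ⟨k', hk', rfl⟩
  obtain ⟨s, hs, hs'⟩ := h.mem_subsetInv_of_mul_inv_mem (g := 1) (u := u) (n := n) hb
    (by simpa using hk') (by rw [hu, h.cocycle_one hb]; ring)
  exact ⟨_, by simpa using hs', by simp [hs]⟩

lemma IsGoodSet.tempered_returnSet (h : IsGoodSet ν R B₀) {C : ℝ≥0∞} {ι : Type*} [LinearOrder ι]
    {F : ι → B × Fin N → Set (B × Fin N)} (hF : ∀ i x, ∀ y ∈ F i x, maharamRelI R N x y) {i : ι}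
    (hC : ∀ b ∈ B₀, ∀ t, eCard (⋃ s : ι, ⋃ _ : s < i, subsetMul (subsetInv (F s)) (F i) (b, t)) ≤
      C * eCard (F i (b, t))) {b : B} {n : ℤ} (hb : b ∈ B₀) :
    eCard {k : Γ | ∃ j, j < i ∧ ∃ g ∈ returnSet R B₀ (F i) (b, n),
      g * k⁻¹ ∈ returnSet R B₀ (F j) (k • b, n + R k b)} ≤
      C * eCard (returnSet R B₀ (F i) (b, n)) := by
  by_cases hne : (returnSet R B₀ (F i) (b, n)).Nonempty
  · obtain ⟨g, -, t, t', ht, -⟩ := hne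
    simp only at ht
    subst ht
    rw [h.eCard_returnSet (hF i) hb]
    refine le_trans ?_ (hC b hb t)
    rw [← eCard_image (h.injective_orbit hb ((t : ℕ) : ℤ)).injOn,
      ← eCard_image (injective_prod_fin_cast (B := B) (N := N)).injOn]
    refine eCard_mono ?_
    rintro - ⟨k, ⟨j, hj, g, hg, hgk⟩, rfl⟩
    obtain ⟨u, hu, hmem⟩ := (mem_returnSet hb).1 hg
    obtain ⟨s, hs, hs'⟩ := h.mem_subsetInv_of_mul_inv_mem hb hgk hu
    refine ⟨(k • b, s), ?_, by simp [hs]⟩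
    simp only [subsetMul, Set.mem_iUnion]
    exact ⟨j, hj, _, hmem, hs'⟩
  · have h0 := Set.not_nonempty_iff_eq_empty.1 hne
    have : {k : Γ | ∃ j, j < i ∧ ∃ g ∈ returnSet R B₀ (F i) (b, n),
      g * k⁻¹ ∈ returnSet R B₀ (F j) (k • b, n + R k b)} = ∅ := by
      ext k; simp [h0]
    rw [this, eCard_eq_zero.2 rfl]
    exact zero_le

end ReturnSet

/-! ### Countably many indices suffice -/

section BaseData

variable {Γ B : Type*} [Group Γ] [Countable Γ] [MeasurableSpace B] [MulAction Γ B]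
  [MeasurableConstSMul Γ B] {ν : Measure B} {R : Γ → B → ℤ} {N : ℕ} {B₀ : Set B}

/-- Return sets are finite subsets of a countable group, so each `F i` becomes a measurable function
with countably many values, to which `exists_seq_ae_eventually_eq` applies. As `thetaI` charges
every point, the conclusion holds for all `t` simultaneously. -/
lemma IsGoodSet.exists_seq_index [MeasurableSpace.CountablyGenerated B] [IsProbabilityMeasure ν]
    (h : IsGoodSet ν R B₀) {lam : ℝ} (hlam : 0 < lam) (hR : ∀ g, Measurable (R g))
    {ι : Type*} [Nonempty ι] {F : ι → B × Fin N → Set (B × Fin N)}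
    (hF : ∀ i x, ∀ y ∈ F i x, maharamRelI R N x y) (hfin : ∀ i x, (F i x).Finite)
    (hmeas : ∀ i, MeasurableSet {z : (B × Fin N) × (B × Fin N) | z.2 ∈ F i z.1}) :
    ∃ q : ℕ → ι, ∀ i, ∃ k : ℕ → ℕ, ∀ᵐ b ∂ν, ∀ t, ∀ᶠ j in atTop,
      F (q (k j)) (b, t) = F i (b, t) := by
  set c : ι → B × Fin N → Finset Γ := fun i y =>
    (h.finite_returnSet (hF i) (hfin i) (y.1, ((y.2 : ℕ) : ℤ))).toFinset with hc
  have hcm : ∀ i a, MeasurableSet {y | c i y = a} := by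
    intro i a
    have : {y | c i y = a} = ⋂ g : Γ,
        {y | g ∈ returnSet R B₀ (F i) (y.1, ((y.2 : ℕ) : ℤ)) ↔ g ∈ a} := by
      ext y
      simp [hc, Finset.ext_iff]
    rw [this]
    refine MeasurableSet.iInter fun g => MeasurableSet.iff ?_ (MeasurableSet.const _)
    have hm : Measurable fun y : B × Fin N => (y.1, ((y.2 : ℕ) : ℤ)) :=
      measurable_fst.prodMk
        ((measurable_of_countable fun t : Fin N => ((t : ℕ) : ℤ)).comp measurable_snd)
    exact hm (measurableSet_returnSet h.measurableSet hR (hmeas i) g)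
  obtain ⟨q, hq⟩ := exists_seq_ae_eventually_eq (ν.prod (thetaI lam N)) c hcm
  refine ⟨q, fun i => ?_⟩
  obtain ⟨k, hk⟩ := hq i
  refine ⟨k, ?_⟩
  filter_upwards [ae_forall_of_ae_prod_thetaI hlam hk, h.ae_mem] with b hb hb0 t
  filter_upwards [hb t] with j hj
  exact h.eq_of_returnSet_eq (hF _) (hF _) hb0 (Set.Finite.toFinset_inj.1 hj)

/-- Pointwise combinatorial conditions along a sequence of indices, on a good set. -/
structure IsTemperedOn {ι : Type*} [LinearOrder ι] (F : ι → B × Fin N → Set (B × Fin N))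
    (B₀ : Set B) (q : ℕ → ι) (C : ℝ≥0) : Prop where
  incidence : ∀ n, ∀ b ∈ B₀, ∀ t, ∀ z ∈ F (q n) (b, t),
    eCard (subsetInv (F (q n)) z) ≤ C * eCard (F (q n) (b, t))
  tempered : ∀ n, ∀ b ∈ B₀, ∀ t,
    eCard (⋃ s : ι, ⋃ _ : s < q n, subsetMul (subsetInv (F s)) (F (q n)) (b, t)) ≤
      C * eCard (F (q n) (b, t))

/-- Regularity gives incidence from `t = r` and temperedness from `t < r`. In the other case
incidence comes from `|F_r⁻¹(z)| ≤ b_r ≤ C₁ a_r ≤ C₁ |F_r(y)|`. The set `B₀` depends on `q` because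
the uniform bounds have a null set for each index, and only countably many can be discarded; `C`
does not depend on `q`. -/
lemma exists_isTemperedOn [IsProbabilityMeasure ν] {lam : ℝ} (hlam : 0 < lam)
    (hν : ∀ g : Γ, Measure.QuasiMeasurePreserving (fun b : B => g • b) ν ν)
    (hfree : ∀ᵐ b ∂ν, ∀ g : Γ, g • b = b → g = 1)
    (hcoc : ∀ g h, ∀ᵐ b ∂ν, R (g * h) b = R g (h • b) + R h b)
    {𝕀 : Set ℝ} {F : 𝕀 → B × Fin N → Set (B × Fin N)}
    (hF : IsBorelFamily (maharamRelI R N) 𝕀 F)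
    (hF' : IsRegularFamily (ν.prod (thetaI lam N)) F ∨
      (IsUniformFamily (ν.prod (thetaI lam N)) F ∧ IsTemperedFamily (ν.prod (thetaI lam N)) F)) :
    ∃ C : ℝ≥0, C ≠ 0 ∧ ∀ q : ℕ → 𝕀, ∃ B₀, IsGoodSet ν R B₀ ∧ IsTemperedOn F B₀ q C := by
  rcases hF' with ⟨C, hC, hreg⟩ | ⟨⟨C₁, a, b, hC₁, hab, huni⟩, -, C₂, hC₂, htemp⟩
  · refine ⟨C, hC.ne', fun q => ?_⟩
    obtain ⟨B₀, hB₀, hp⟩ := exists_isGoodSet hν hfree hcoc (ae_forall_of_ae_prod_thetaI hlam hreg)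
    refine ⟨B₀, hB₀, fun n b hb t z hz => ?_, fun n b hb t => ?_⟩
    · refine le_trans (eCard_mono ?_) (hp b hb t (q n))
      intro y hy
      simp only [subsetMul, Set.mem_iUnion]
      exact ⟨q n, le_rfl, z, hz, hy⟩
    · refine le_trans (eCard_mono ?_) (hp b hb t (q n))
      exact Set.iUnion_mono fun s => Set.iUnion_mono' fun hs => ⟨hs.le, le_rfl⟩
  · refine ⟨max C₁ C₂, (lt_max_of_lt_left hC₁).ne', fun q => ?_⟩
    have huni' := ae_all_iff.2 fun n => ae_forall_of_ae_prod_thetaI hlam (huni (q n))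
    obtain ⟨B₀, hB₀, hp⟩ := exists_isGoodSet hν hfree hcoc
      (huni'.and (ae_forall_of_ae_prod_thetaI hlam htemp))
    refine ⟨B₀, hB₀, fun n b' hb t z hz => ?_, fun n b' hb t => ?_⟩
    · obtain ⟨b'', t'⟩ := z
      -- The point `z` is in the orbit of a point over `B₀`, hence also lies over `B₀`, where the
      -- bound on the inverse is valid.
      obtain ⟨g, rfl, -⟩ := hB₀.exists_of_maharamRelI hb (hF.subset_class _ _ _ hz)
      calc eCard (subsetInv (F (q n)) (g • b', t')) ≤ b (q n) :=
            ((hp _ (hB₀.smul_mem g b' hb)).1 n t').2.2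
        _ ≤ C₁ * a (q n) := by exact_mod_cast (hab (q n)).2.2
        _ ≤ (max C₁ C₂ : ℝ≥0) * eCard (F (q n) (b', t)) := by
            gcongr
            · exact le_max_left _ _
            · exact ((hp _ hb).1 n t).1.1
    · refine ((hp b' hb).2 t (q n)).trans ?_
      gcongr
      exact le_max_right _ _

end BaseData

/-! ### The extension by a probability measure preserving action -/

/-- The measure on `ℤ` with mass `lam ^ (-n)` at `n`. -/
noncomputable def thetaZ (lam : ℝ) : Measure ℤ :=
  Measure.sum fun n : ℤ => ENNReal.ofReal (lam ^ (-n)) • Measure.dirac n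

instance sFinite_thetaZ (lam : ℝ) : SFinite (thetaZ lam) := by
  unfold thetaZ; infer_instance

lemma lintegral_thetaZ (lam : ℝ) (h : ℤ → ℝ≥0∞) :
    ∫⁻ n, h n ∂thetaZ lam = ∑' n, ENNReal.ofReal (lam ^ (-n)) * h n := by
  rw [thetaZ, lintegral_sum_measure]
  simp

lemma lintegral_thetaI (lam : ℝ) (N : ℕ) (h : Fin N → ℝ≥0∞) :
    ∫⁻ t, h t ∂thetaI lam N =
      ∑ t : Fin N, ENNReal.ofReal (lam⁻¹ ^ (t : ℕ) / ∑ k : Fin N, lam⁻¹ ^ (k : ℕ)) * h t := by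
  rw [thetaI, lintegral_finsetSum_measure]
  simp

lemma injective_fin_cast_int (N : ℕ) : Function.Injective fun t : Fin N => ((t : ℕ) : ℤ) :=
  fun _ _ h => Fin.ext (Int.ofNat_inj.1 h)

/-- Integration of a function supported in `{0, …, N - 1}`. -/
lemma lintegral_thetaZ_of_support {lam : ℝ} (hlam : 0 < lam) {N : ℕ} {h : ℤ → ℝ≥0∞}
    (hh : ∀ n, h n ≠ 0 → ∃ t : Fin N, ((t : ℕ) : ℤ) = n) :
    ∫⁻ n, h n ∂thetaZ lam = ENNReal.ofReal (∑ k : Fin N, lam⁻¹ ^ (k : ℕ)) *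
      ∫⁻ t, h ((t : Fin N) : ℕ) ∂thetaI lam N := by
  rw [lintegral_thetaZ, lintegral_thetaI,
    ← (injective_fin_cast_int N).tsum_eq, tsum_fintype, Finset.mul_sum]
  · refine Finset.sum_congr rfl fun t _ => ?_
    have hs : 0 < ∑ k : Fin N, lam⁻¹ ^ (k : ℕ) :=
      Finset.sum_pos (fun k _ => by positivity) ⟨t, Finset.mem_univ t⟩
    rw [← mul_assoc, ← ENNReal.ofReal_mul hs.le, mul_div_cancel₀ _ hs.ne']
    simp
  · intro n hn
    refine hh n fun h0 => hn ?_
    simp [h0]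

/-- Each `t ∈ I` has mass `lam ^ (-t) ≥ 1`. -/
lemma sum_le_lintegral_thetaZ {lam : ℝ} (hlam0 : 0 < lam) (hlam1 : lam < 1) (N : ℕ)
    (h : ℤ → ℝ≥0∞) : ∑ t : Fin N, h ((t : ℕ) : ℤ) ≤ ∫⁻ n, h n ∂thetaZ lam := by
  rw [lintegral_thetaZ]
  refine le_trans ?_ (ENNReal.tsum_comp_le_tsum_of_injective (injective_fin_cast_int N) _)
  rw [tsum_fintype]
  refine Finset.sum_le_sum fun t _ => le_mul_of_one_le_left zero_le ?_
  rw [ENNReal.one_le_ofReal, zpow_neg, zpow_natCast]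
  exact (one_le_inv₀ (by positivity)).2 (pow_le_one₀ hlam0.le hlam1.le)

section Extension

variable {Γ B X : Type*} [Group Γ] [MulAction Γ B] [MulAction Γ X]

/-- The map `(b, x, n) ↦ (g b, g x, n + R g b)`, where the cocycle `R` is replaced by `0` outside
the good set `B₀`. -/
noncomputable def extMap (R : Γ → B → ℤ) (B₀ : Set B) (g : Γ) (z : B × X × ℤ) : B × X × ℤ :=
  (g • z.1, g • z.2.1, z.2.2 + B₀.indicator (R g) z.1)

/-- The return sets, lifted to the extension. -/
def extReturnSet {N : ℕ} {ι : Type*} (X : Type*) (R : Γ → B → ℤ) (B₀ : Set B)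
    (F : ι → B × Fin N → Set (B × Fin N)) (i : ι) (z : B × X × ℤ) : Set Γ :=
  returnSet R B₀ (F i) (z.1, z.2.2)

/-- The absolute value of `f`, extended by zero to `B × X × ℤ`. -/
def absExtend {N : ℕ} (f : B × X × Fin N → ℝ) (z : B × X × ℤ) : ℝ :=
  ∑ t : Fin N, if ((t : ℕ) : ℤ) = z.2.2 then |f (z.1, z.2.1, t)| else 0

variable {N : ℕ}

omit [MulAction Γ B] [MulAction Γ X] in
lemma absExtend_coe (f : B × X × Fin N → ℝ) (b : B) (x : X) (t : Fin N) :
    absExtend f (b, x, ((t : ℕ) : ℤ)) = |f (b, x, t)| := by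
  unfold absExtend
  rw [Finset.sum_eq_single t]
  · simp
  · intro s _ hst
    have : ((s : ℕ) : ℤ) ≠ ((t : ℕ) : ℤ) := fun h => hst (injective_fin_cast_int N h)
    simp only [this, if_false]
  · simp

lemma absExtend_of_forall_ne (f : B × X × Fin N → ℝ) {z : B × X × ℤ}
    (h : ∀ t : Fin N, ((t : ℕ) : ℤ) ≠ z.2.2) : absExtend f z = 0 :=
  Finset.sum_eq_zero fun t _ => if_neg (h t)

lemma absExtend_nonneg (f : B × X × Fin N → ℝ) (z : B × X × ℤ) : 0 ≤ absExtend f z :=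
  Finset.sum_nonneg fun t _ => by split_ifs <;> positivity

/-- A pointwise property of `absExtend` can be checked on `B × X × {0, …, N - 1}`. -/
lemma absExtend_cases {p : B × X × ℤ → Prop}
    (h1 : ∀ b x (t : Fin N), p (b, x, ((t : ℕ) : ℤ)))
    (h2 : ∀ z, (∀ t : Fin N, ((t : ℕ) : ℤ) ≠ z.2.2) → p z) (z : B × X × ℤ) : p z := by
  by_cases h : ∃ t : Fin N, ((t : ℕ) : ℤ) = z.2.2
  · obtain ⟨t, ht⟩ := h
    obtain ⟨b, x, n⟩ := z
    simp only at ht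
    subst ht
    exact h1 b x t
  · exact h2 z fun t ht => h ⟨t, ht⟩

variable [MeasurableSpace B] [MeasurableSpace X] {ν : Measure B} {μ : Measure X} {lam : ℝ}

lemma measurable_absExtend {f : B × X × Fin N → ℝ} (hf : Measurable f) :
    Measurable (absExtend f) := by
  refine Finset.measurable_sum _ fun t _ => Measurable.ite ?_ ?_ measurable_const
  · have : Measurable fun z : B × X × ℤ => z.2.2 := by fun_prop
    exact measurableSet_eq_fun measurable_const this
  · exact (hf.comp (by fun_prop)).abs

lemma lintegral_ext [SFinite ν] [SFinite μ] {h : B × X × ℤ → ℝ≥0∞} (hh : Measurable h) :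
    ∫⁻ z, h z ∂(ν.prod (μ.prod (thetaZ lam))) =
      ∫⁻ b, ∫⁻ x, ∫⁻ n, h (b, x, n) ∂thetaZ lam ∂μ ∂ν := by
  rw [lintegral_prod _ hh.aemeasurable]
  refine lintegral_congr fun b => ?_
  have hb : Measurable fun y => h (b, y) := hh.comp measurable_prodMk_left
  rw [lintegral_prod _ hb.aemeasurable]

lemma lintegral_absExtend [SFinite ν] [SFinite μ] (hlam : 0 < lam) {f : B × X × Fin N → ℝ}
    (hf : Measurable f) {φ : ℝ → ℝ≥0∞} (hφ : Measurable φ) (hφ0 : φ 0 = 0) :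
    ∫⁻ z, φ (absExtend f z) ∂(ν.prod (μ.prod (thetaZ lam))) =
      ENNReal.ofReal (∑ k : Fin N, lam⁻¹ ^ (k : ℕ)) *
        ∫⁻ y, φ |f y| ∂(ν.prod (μ.prod (thetaI lam N))) := by
  have hφf : Measurable fun y => φ |f y| := hφ.comp hf.abs
  have hI : Measurable fun b => ∫⁻ y, φ |f (b, y)| ∂(μ.prod (thetaI lam N)) :=
    Measurable.lintegral_prod_right' hφf
  have hφe : Measurable fun z => φ (absExtend f z) := hφ.comp (measurable_absExtend hf)
  rw [lintegral_ext hφe, lintegral_prod _ hφf.aemeasurable,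
    ← lintegral_const_mul _ hI]
  refine lintegral_congr fun b => ?_
  have hfb : Measurable fun y : X × Fin N => φ |f (b, y)| := hφf.comp (by fun_prop)
  rw [lintegral_prod _ hfb.aemeasurable,
    ← lintegral_const_mul _ (Measurable.lintegral_prod_right' hfb)]
  refine lintegral_congr fun x => ?_
  rw [lintegral_thetaZ_of_support hlam (N := N)]
  · simp only [absExtend_coe]
  · intro n hn
    by_contra hne
    push Not at hne
    rw [absExtend_of_forall_ne f hne] at hn
    exact hn hφ0

lemma lintegral_lintegral_sum_le [SFinite ν] [SFinite μ] (hlam0 : 0 < lam) (hlam1 : lam < 1)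
    (N : ℕ) {h : B × X × ℤ → ℝ≥0∞} (hh : Measurable h) :
    ∫⁻ x, ∫⁻ b, ∑ t : Fin N, h (b, x, ((t : ℕ) : ℤ)) ∂ν ∂μ ≤
      ∫⁻ z, h z ∂(ν.prod (μ.prod (thetaZ lam))) := by
  rw [lintegral_ext hh, lintegral_lintegral_swap]
  · exact lintegral_mono fun b => lintegral_mono fun x => sum_le_lintegral_thetaZ hlam0 hlam1 N _
  · refine Measurable.aemeasurable ?_
    refine Finset.measurable_sum _ fun t _ => hh.comp (by fun_prop)

lemma measure_fin_le [IsProbabilityMeasure ν] [IsProbabilityMeasure μ] (hlam : 0 < lam) :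
    (ν.prod (μ.prod (thetaZ lam))) {z | ∃ t : Fin N, ((t : ℕ) : ℤ) = z.2.2} ≤
      ENNReal.ofReal (∑ k : Fin N, lam⁻¹ ^ (k : ℕ)) * thetaI lam N Set.univ := by
  set A : Set ℤ := Set.range fun t : Fin N => ((t : ℕ) : ℤ) with hA
  have hset : {z : B × X × ℤ | ∃ t : Fin N, ((t : ℕ) : ℤ) = z.2.2} =
      Set.univ ×ˢ (Set.univ ×ˢ A) := by
    ext z; simp [hA]
  rw [hset, Measure.prod_prod, Measure.prod_prod, measure_univ, measure_univ, one_mul, one_mul,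
    ← setLIntegral_one, ← lintegral_indicator (MeasurableSet.of_discrete),
    lintegral_thetaZ_of_support hlam (N := N)]
  · simp [hA]
  · intro n hn
    by_contra h
    exact hn (Set.indicator_of_notMem (s := A) h _)

/-! ### Invariance of the extended measure and transfer of the combinatorial conditions -/

variable [MeasurableConstSMul Γ B] [MeasurableConstSMul Γ X] {R : Γ → B → ℤ} {B₀ : Set B}

lemma measurable_extMap (hB₀ : MeasurableSet B₀) (hR : ∀ g, Measurable (R g)) (g : Γ) :
    Measurable (extMap (X := X) R B₀ g) := by
  have h1 : Measurable fun z : B × X × ℤ => B₀.indicator (R g) z.1 :=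
    ((hR g).indicator hB₀).comp measurable_fst
  have h2 : Measurable fun z : B × X × ℤ => z.2.2 := by fun_prop
  exact (measurable_fst.const_smul g).prodMk
    (((measurable_fst.comp measurable_snd).const_smul g).prodMk (h2.add h1))

lemma lintegral_thetaZ_add (hlam : 0 < lam) (h : ℤ → ℝ≥0∞) (r : ℤ) :
    ∫⁻ n, h (n + r) ∂thetaZ lam = ENNReal.ofReal (lam ^ r) * ∫⁻ n, h n ∂thetaZ lam := by
  rw [lintegral_thetaZ, lintegral_thetaZ, ← ENNReal.tsum_mul_left,
    ← (Equiv.addRight r).tsum_eq fun n => ENNReal.ofReal (lam ^ r) *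
      (ENNReal.ofReal (lam ^ (-n)) * h n)]
  refine tsum_congr fun n => ?_
  rw [← mul_assoc, ← ENNReal.ofReal_mul (by positivity), ← zpow_add₀ hlam.ne']
  simp

/-- With `R` set to `0` off `B₀` the maps form an action everywhere. The factor `lam ^ R g b`
produced by the shift in `ℤ` is the density in the change of variables by `g` on `B`. -/
lemma IsGoodSet.isMPAction_extMap [IsProbabilityMeasure ν] [IsProbabilityMeasure μ]
    [SMulInvariantMeasure Γ X μ] (h : IsGoodSet ν R B₀)
    (hν : ∀ g : Γ, Measure.QuasiMeasurePreserving (fun b : B => g • b) ν ν)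
    (hlam0 : 0 < lam) (hlam1 : lam < 1) (hRmeas : ∀ g, Measurable (R g))
    (hR : ∀ g, ∀ᵐ b ∂ν, (R g b : ℝ) = logRN ν lam g b) :
    IsMPAction (extMap (X := X) R B₀) (ν.prod (μ.prod (thetaZ lam))) where
  one z := by
    by_cases hb : z.1 ∈ B₀ <;> simp [extMap, hb, h.cocycle_one]
  mul g g' z := by
    by_cases hb : z.1 ∈ B₀
    · simp only [extMap, mul_smul, Set.indicator_of_mem hb,
        Set.indicator_of_mem (h.smul_mem g' _ hb), h.cocycle _ hb]
      rw [add_assoc, add_comm (R g' z.1)]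
    · have hb' : g' • z.1 ∉ B₀ := fun hb' => hb (h.smul_mem_iff.1 hb')
      simp [extMap, mul_smul, hb, hb']
  measurePreserving g := by
    refine ⟨measurable_extMap h.measurableSet hRmeas g, Measure.ext_of_lintegral _ fun u hu => ?_⟩
    have hT := measurable_extMap (X := X) h.measurableSet hRmeas g
    have huT : Measurable fun z => u (extMap R B₀ g z) := hu.comp hT
    rw [lintegral_map hu hT, lintegral_ext huT, lintegral_ext hu]
    set G : B → X → ℝ≥0∞ := fun b x => ∫⁻ n, u (b, x, n) ∂thetaZ lam with hG
    have hGm : Measurable (Function.uncurry G) := by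
      refine Measurable.lintegral_prod_right' (f := fun p : (B × X) × ℤ => u (p.1.1, p.1.2, p.2)) ?_
      exact hu.comp (by fun_prop)
    have hGm' : Measurable fun b => ∫⁻ x, G b x ∂μ := Measurable.lintegral_prod_right' hGm
    rw [lintegral_eq_lintegral_smul_mul_zpow hν hlam0 hlam1 hR g hGm']
    refine lintegral_congr_ae ?_
    filter_upwards [h.ae_mem] with b hb
    have hGb : Measurable (G (g • b)) := hGm.comp measurable_prodMk_left
    calc ∫⁻ x, ∫⁻ n, u (extMap R B₀ g (b, x, n)) ∂thetaZ lam ∂μ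
        = ∫⁻ x, ENNReal.ofReal (lam ^ R g b) * G (g • b) (g • x) ∂μ := by
          refine lintegral_congr fun x => ?_
          simp only [extMap, Set.indicator_of_mem hb]
          exact lintegral_thetaZ_add hlam0 (fun n => u (g • b, g • x, n)) (R g b)
      _ = ENNReal.ofReal (lam ^ R g b) * ∫⁻ x, G (g • b) (g • x) ∂μ :=
          lintegral_const_mul _ (hGb.comp (measurable_const_smul g))
      _ = ENNReal.ofReal (lam ^ R g b) * ∫⁻ x, G (g • b) x ∂μ := by
          rw [(measurePreserving_smul g μ).lintegral_comp hGb]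

omit [MulAction Γ X] [MeasurableConstSMul Γ X] in
lemma measurableSet_extReturnSet (hB₀ : MeasurableSet B₀)
    (hR : ∀ g, Measurable (R g)) {ι : Type*} {F : ι → B × Fin N → Set (B × Fin N)} {i : ι}
    (hF : MeasurableSet {z : (B × Fin N) × (B × Fin N) | z.2 ∈ F i z.1}) (g : Γ) :
    MeasurableSet {z | g ∈ extReturnSet X R B₀ F i z} := by
  have hm : Measurable fun z : B × X × ℤ => (z.1, z.2.2) := by fun_prop
  exact hm (measurableSet_returnSet hB₀ hR hF g)

omit [MeasurableSpace X] [MeasurableConstSMul Γ B] [MeasurableConstSMul Γ X] in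
-- The return sets do not depend on `x`, so these are the conditions on the base; off `B₀` all
-- return sets are empty.
lemma IsTemperedOn.isTemperedAction {ι : Type*} [LinearOrder ι]
    {F : ι → B × Fin N → Set (B × Fin N)} {q : ℕ → ι} {C : ℝ≥0}
    (hFq : IsTemperedOn F B₀ q C) (h : IsGoodSet ν R B₀)
    (hF : ∀ i x, ∀ y ∈ F i x, maharamRelI R N x y) (hfin : ∀ i x, (F i x).Finite) :
    IsTemperedAction (extMap (X := X) R B₀) (extReturnSet X R B₀ F) (Set.range q) C where
  finite i z := h.finite_returnSet (hF i) (hfin i) _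
  incidence := by
    rintro - ⟨n, rfl⟩ z k hk
    have hb : z.1 ∈ B₀ := h.smul_mem_iff.1 hk.1
    simp only [extReturnSet, extMap, Set.indicator_of_mem hb] at hk ⊢
    exact h.incidence_returnSet (hF _) (hFq.incidence n) hb hk
  tempered := by
    rintro - ⟨n, rfl⟩ z
    by_cases hb : z.1 ∈ B₀
    · simp only [extReturnSet, extMap, Set.indicator_of_mem hb]
      refine le_trans (eCard_mono ?_) (h.tempered_returnSet hF (hFq.tempered n) hb)
      rintro k ⟨j, -, hj⟩
      exact ⟨j, hj⟩
    · have : {k | ∃ j ∈ Set.range q, j < q n ∧ ∃ g ∈ extReturnSet X R B₀ F (q n) z,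
          g * k⁻¹ ∈ extReturnSet X R B₀ F j (extMap R B₀ k z)} = ∅ := by
        ext k
        simp only [Set.mem_ofPred_eq, Set.mem_empty_iff_false, iff_false]
        rintro ⟨j, -, -, g, hg, -⟩
        exact hb hg.1
      rw [this, eCard_eq_zero.2 rfl]
      exact zero_le

omit [MeasurableSpace X] [MeasurableConstSMul Γ B] [MeasurableConstSMul Γ X] in
lemma IsGoodSet.image_liftSubset (h : IsGoodSet ν R B₀) {ι : Type*}
    {F : ι → B × Fin N → Set (B × Fin N)} (i : ι) {b : B} (hb : b ∈ B₀) (x : X) (t : Fin N) :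
    (fun y : B × X × Fin N => (y.1, y.2.1, ((y.2.2 : ℕ) : ℤ))) ''
        liftSubset X R N (F i) (b, x, t) =
      (fun g : Γ => extMap R B₀ g (b, x, ((t : ℕ) : ℤ))) ''
        extReturnSet X R B₀ F i (b, x, ((t : ℕ) : ℤ)) := by
  ext ⟨b', x', n⟩
  constructor
  · rintro ⟨⟨b'', x'', t'⟩, ⟨hU, hrel⟩, hy⟩
    have := eqvGen_exists_eq
      (G := fun (g : Γ) (y : B × X × ℤ) => (g • y.1, g • y.2.1, y.2.2 + R g y.1))
      (A := {y | y.1 ∈ B₀}) (fun g y => h.smul_mem_iff)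
      (fun y hy => by simp [h.cocycle_one hy])
      (fun y hy g g' => by
        simp only [Prod.mk.injEq]
        exact ⟨mul_smul _ _ _, mul_smul _ _ _, by rw [h.cocycle _ hy]; ring⟩) hrel
    obtain ⟨g, hg⟩ := this.2 hb
    simp only [Prod.mk.injEq] at hg
    obtain ⟨rfl, rfl, ht'⟩ := hg
    refine ⟨g, (mem_returnSet hb).2 ⟨t', ht', hU⟩, ?_⟩
    rw [← hy]
    simp [extMap, hb, ht']
  · rintro ⟨g, hg, hy⟩
    obtain ⟨t', ht', hU⟩ := (mem_returnSet hb).1 hg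
    refine ⟨(g • b, g • x, t'), ⟨hU, ?_⟩, ?_⟩
    · refine Relation.EqvGen.rel _ _ ⟨g, ?_⟩
      simp [ht']
    · rw [← hy]
      simp [extMap, hb, ht']

omit [MeasurableSpace X] [MeasurableConstSMul Γ B] [MeasurableConstSMul Γ X] in
lemma IsGoodSet.setAvg_liftSubset (h : IsGoodSet ν R B₀) {ι : Type*}
    {F : ι → B × Fin N → Set (B × Fin N)} (i : ι) {b : B} (hb : b ∈ B₀) (x : X) (t : Fin N)
    (f : B × X × Fin N → ℝ) :
    setAvg (liftSubset X R N (F i) (b, x, t)) (fun y => ‖f y‖ₑ) =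
      orbitAvg (extMap R B₀) (extReturnSet X R B₀ F) (fun z => ENNReal.ofReal (absExtend f z)) i
        (b, x, ((t : ℕ) : ℤ)) := by
  have hinj : Function.Injective
      (fun y : B × X × Fin N => (y.1, y.2.1, ((y.2.2 : ℕ) : ℤ))) := by
    rintro ⟨b, x, t⟩ ⟨b', x', t'⟩ hy
    simp only [Prod.mk.injEq] at hy
    simp only [Prod.mk.injEq]
    exact ⟨hy.1, hy.2.1, injective_fin_cast_int N hy.2.2⟩
  have hinj' : Function.Injective
      (fun g : Γ => extMap R B₀ g (b, x, ((t : ℕ) : ℤ))) :=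
    fun g g' hg => h.smul_injective hb (congrArg Prod.fst hg)
  unfold orbitAvg
  rw [← setAvg_image hinj'.injOn (fun z => ENNReal.ofReal (absExtend f z)),
    ← h.image_liftSubset i hb, setAvg_image hinj.injOn]
  refine setAvg_congr fun y _ => ?_
  rw [absExtend_coe f y.1 y.2.1 y.2.2, ← Real.enorm_eq_ofReal_abs]

end Extension

/-! ### The weighted maximal function -/

section WeightedMaximal

variable {Γ B X : Type*} [Group Γ] [MulAction Γ B] [MulAction Γ X]
  [MeasurableSpace B] [MeasurableSpace X] {ν : Measure B} {μ : Measure X} {lam : ℝ} {N : ℕ}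
  {R : Γ → B → ℤ} {B₀ : Set B} {𝕀 : Set ℝ} {F : 𝕀 → B × Fin N → Set (B × Fin N)} {q : ℕ → 𝕀}

/-- The averages of `|f|` over the lifted family, as orbit averages on the extension. -/
noncomputable def liftAvg (R : Γ → B → ℤ) (B₀ : Set B) (F : 𝕀 → B × Fin N → Set (B × Fin N))
    (f : B × X × Fin N → ℝ) : 𝕀 → B × X × ℤ → ℝ≥0∞ :=
  orbitAvg (extMap R B₀) (extReturnSet X R B₀ F) fun z => ENNReal.ofReal (absExtend f z)

/-- The maximal function of `|f|` over the lifted family, along the sequence `q` of indices. -/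
noncomputable def liftMax (R : Γ → B → ℤ) (B₀ : Set B) (F : 𝕀 → B × Fin N → Set (B × Fin N))
    (q : ℕ → 𝕀) (f : B × X × Fin N → ℝ) : B × X × ℤ → ℝ≥0∞ :=
  orbitMax (extMap R B₀) (extReturnSet X R B₀ F) q fun z => ENNReal.ofReal (absExtend f z)

omit [MeasurableSpace X] in
lemma weightedMaximal_eq_iSup (h : IsGoodSet ν R B₀) (f : B × X × Fin N → ℝ) (ψ : B → ℝ) (x : X) :
    weightedMaximal ν R N F f ψ x = ⨆ r : 𝕀, ∫⁻ b, ((N : ℝ≥0∞)⁻¹ *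
      ∑ t : Fin N, liftAvg R B₀ F f r (b, x, ((t : ℕ) : ℤ))) * ENNReal.ofReal (ψ b) ∂ν := by
  unfold weightedMaximal
  refine iSup_congr fun r => lintegral_congr_ae ?_
  filter_upwards [h.ae_mem] with b hb
  simp only [h.setAvg_liftSubset _ hb, liftAvg]

omit [MeasurableSpace B] [MeasurableSpace X] in
lemma liftMax_const_mul {c : ℝ} (hc : 0 ≤ c) (f : B × X × Fin N → ℝ) (z : B × X × ℤ) :
    liftMax R B₀ F q (fun y => c * f y) z = ENNReal.ofReal c * liftMax R B₀ F q f z := by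
  have habs : ∀ z, ENNReal.ofReal (absExtend (fun y => c * f y) z) =
      ENNReal.ofReal c * ENNReal.ofReal (absExtend f z) := by
    intro z
    rw [← ENNReal.ofReal_mul hc]
    congr 1
    unfold absExtend
    rw [Finset.mul_sum]
    refine Finset.sum_congr rfl fun t _ => ?_
    rw [abs_mul, abs_of_nonneg hc, mul_ite, mul_zero]
  unfold liftMax orbitMax orbitAvg setAvg
  rw [ENNReal.mul_iSup]
  refine iSup_congr fun n => ?_
  simp only [habs]
  rw [ENNReal.tsum_mul_left, mul_div_assoc]

omit [MeasurableSpace B] [MeasurableSpace X] in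
lemma liftMax_le_of_forall_le {K : ℝ} {f : B × X × Fin N → ℝ} (hf : ∀ y, |f y| ≤ K) (hK : 0 ≤ K)
    (z : B × X × ℤ) : liftMax R B₀ F q f z ≤ ENNReal.ofReal K := by
  refine iSup_le fun n => (setAvg_mono fun g _ => ?_).trans (setAvg_const_le _)
  refine ENNReal.ofReal_le_ofReal ?_
  refine absExtend_cases (N := N) (p := fun z => absExtend f z ≤ K) (fun b x t => ?_) (fun z hz => ?_) _
  · rw [absExtend_coe]; exact hf _
  · rwa [absExtend_of_forall_ne f hz]

variable [Countable Γ] [MeasurableConstSMul Γ B] [MeasurableConstSMul Γ X]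

lemma measurable_liftAvg (h : IsGoodSet ν R B₀) (hRmeas : ∀ g, Measurable (R g))
    (hmeas : ∀ i, MeasurableSet {z : (B × Fin N) × (B × Fin N) | z.2 ∈ F i z.1})
    {f : B × X × Fin N → ℝ} (hf : Measurable f) (r : 𝕀) : Measurable (liftAvg R B₀ F f r) :=
  measurable_orbitAvg (measurable_extMap h.measurableSet hRmeas)
    (measurableSet_extReturnSet h.measurableSet hRmeas (hmeas r))
    (measurable_absExtend hf).ennreal_ofReal

lemma measurable_liftMax (h : IsGoodSet ν R B₀) (hRmeas : ∀ g, Measurable (R g))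
    (hmeas : ∀ i, MeasurableSet {z : (B × Fin N) × (B × Fin N) | z.2 ∈ F i z.1})
    {f : B × X × Fin N → ℝ} (hf : Measurable f) : Measurable (liftMax R B₀ F q f) :=
  measurable_orbitMax (measurable_extMap h.measurableSet hRmeas)
    (fun i => measurableSet_extReturnSet h.measurableSet hRmeas (hmeas i)) q
    (measurable_absExtend hf).ennreal_ofReal

/-- The supremum over all indices is attained on a countable set of indices. -/
lemma weightedMaximal_eq_iSup_seq (h : IsGoodSet ν R B₀) (hRmeas : ∀ g, Measurable (R g))
    (hmeas : ∀ i, MeasurableSet {z : (B × Fin N) × (B × Fin N) | z.2 ∈ F i z.1})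
    (hq : ∀ i, ∃ k : ℕ → ℕ, ∀ᵐ b ∂ν, ∀ t, ∀ᶠ j in atTop, F (q (k j)) (b, t) = F i (b, t))
    {f : B × X × Fin N → ℝ} (hf : Measurable f) {ψ : B → ℝ} (hψ : AEMeasurable ψ ν) (x : X) :
    weightedMaximal ν R N F f ψ x = ⨆ n, ∫⁻ b, ((N : ℝ≥0∞)⁻¹ *
      ∑ t : Fin N, liftAvg R B₀ F f (q n) (b, x, ((t : ℕ) : ℤ))) * ENNReal.ofReal (ψ b) ∂ν := by
  rw [weightedMaximal_eq_iSup h]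
  refine le_antisymm (iSup_le fun r => ?_) (iSup_le fun n => le_iSup_of_le (q n) le_rfl)
  set u : 𝕀 → B → ℝ≥0∞ := fun r b => ((N : ℝ≥0∞)⁻¹ *
    ∑ t : Fin N, liftAvg R B₀ F f r (b, x, ((t : ℕ) : ℤ))) * ENNReal.ofReal (ψ b) with hu
  have hum : ∀ r, AEMeasurable (u r) ν := by
    intro r
    refine AEMeasurable.mul (Measurable.aemeasurable ?_) hψ.ennreal_ofReal
    refine (Finset.measurable_sum _ fun t _ => ?_).const_mul _
    exact (measurable_liftAvg h hRmeas hmeas hf r).comp (by fun_prop)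
  obtain ⟨k, hk⟩ := hq r
  -- For almost every `b` the integrand is eventually constant along `q (k j)`, so it equals its
  -- lower limit and Fatou's lemma applies.
  calc ∫⁻ b, u r b ∂ν = ∫⁻ b, liminf (fun j => u (q (k j)) b) atTop ∂ν := by
        refine lintegral_congr_ae ?_
        filter_upwards [hk] with b hb
        have hev : ∀ᶠ j in atTop, u r b = u (q (k j)) b := by
          filter_upwards [eventually_all.2 hb] with j hj
          simp only [hu]
          congr 2
          refine Finset.sum_congr rfl fun t _ => ?_
          have : extReturnSet X R B₀ F r (b, x, ((t : ℕ) : ℤ)) =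
              extReturnSet X R B₀ F (q (k j)) (b, x, ((t : ℕ) : ℤ)) := by
            ext g
            by_cases hb0 : b ∈ B₀
            · simp only [extReturnSet, mem_returnSet hb0, hj t]
            · exact ⟨fun hg => absurd hg.1 hb0, fun hg => absurd hg.1 hb0⟩
          simp only [liftAvg, orbitAvg, this]
        exact ((tendsto_const_nhds.congr' hev).liminf_eq).symm
    _ ≤ liminf (fun j => ∫⁻ b, u (q (k j)) b ∂ν) atTop := lintegral_liminf_le' fun j => hum _
    _ ≤ ⨆ n, ∫⁻ b, u (q n) b ∂ν := by
        refine liminf_le_of_le (by isBoundedDefault) fun a ha => ?_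
        obtain ⟨j, hj⟩ := ha.exists
        exact hj.trans (le_iSup (fun n => ∫⁻ b, u (q n) b ∂ν) (k j))

lemma measurable_weightedMaximal [SFinite ν] (h : IsGoodSet ν R B₀)
    (hRmeas : ∀ g, Measurable (R g))
    (hmeas : ∀ i, MeasurableSet {z : (B × Fin N) × (B × Fin N) | z.2 ∈ F i z.1})
    (hq : ∀ i, ∃ k : ℕ → ℕ, ∀ᵐ b ∂ν, ∀ t, ∀ᶠ j in atTop, F (q (k j)) (b, t) = F i (b, t))
    {f : B × X × Fin N → ℝ} (hf : Measurable f) {ψ : B → ℝ} (hψ : AEMeasurable ψ ν) :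
    Measurable fun x => weightedMaximal ν R N F f ψ x := by
  simp only [weightedMaximal_eq_iSup_seq h hRmeas hmeas hq hf hψ]
  refine Measurable.iSup fun n => ?_
  have : ∀ x, ∫⁻ b, ((N : ℝ≥0∞)⁻¹ * ∑ t : Fin N, liftAvg R B₀ F f (q n) (b, x, ((t : ℕ) : ℤ))) *
      ENNReal.ofReal (ψ b) ∂ν = ∫⁻ b, ((N : ℝ≥0∞)⁻¹ *
      ∑ t : Fin N, liftAvg R B₀ F f (q n) (b, x, ((t : ℕ) : ℤ))) *
      ENNReal.ofReal (hψ.mk ψ b) ∂ν := by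
    intro x
    refine lintegral_congr_ae ?_
    filter_upwards [hψ.ae_eq_mk] with b hb
    rw [hb]
  simp only [this]
  refine Measurable.lintegral_prod_left' (f := fun p : B × X => ((N : ℝ≥0∞)⁻¹ *
      ∑ t : Fin N, liftAvg R B₀ F f (q n) (p.1, p.2, ((t : ℕ) : ℤ))) *
      ENNReal.ofReal (hψ.mk ψ p.1)) ?_
  refine Measurable.mul ((Finset.measurable_sum _ fun t _ => ?_).const_mul _) ?_
  · exact (measurable_liftAvg h hRmeas hmeas hf (q n)).comp (by fun_prop)
  · exact (hψ.measurable_mk.comp measurable_fst).ennreal_ofReal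

/-- The supremum moves inside the integral. The factor `N⁻¹ ≤ 1` is dropped, which only affects
constants. -/
lemma weightedMaximal_le (hN : 1 ≤ N) (h : IsGoodSet ν R B₀) (hRmeas : ∀ g, Measurable (R g))
    (hmeas : ∀ i, MeasurableSet {z : (B × Fin N) × (B × Fin N) | z.2 ∈ F i z.1})
    (hq : ∀ i, ∃ k : ℕ → ℕ, ∀ᵐ b ∂ν, ∀ t, ∀ᶠ j in atTop, F (q (k j)) (b, t) = F i (b, t))
    {f : B × X × Fin N → ℝ} (hf : Measurable f) {ψ : B → ℝ} (hψ : AEMeasurable ψ ν) (x : X) :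
    weightedMaximal ν R N F f ψ x ≤
      ∫⁻ b, (∑ t : Fin N, liftMax R B₀ F q f (b, x, ((t : ℕ) : ℤ))) * ENNReal.ofReal (ψ b) ∂ν := by
  rw [weightedMaximal_eq_iSup_seq h hRmeas hmeas hq hf hψ]
  refine iSup_le fun n => lintegral_mono fun b => ?_
  gcongr
  refine (mul_le_of_le_one_left zero_le ?_).trans (Finset.sum_le_sum fun t _ => ?_)
  · exact ENNReal.inv_le_one.2 (by exact_mod_cast hN)
  · exact le_iSup (fun n => liftAvg R B₀ F f (q n) (b, x, ((t : ℕ) : ℤ))) n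

/-- The weighted maximal function only depends on the almost everywhere class of `f`. -/
lemma weightedMaximal_congr_ae [SFinite ν] [SFinite μ] (h : IsGoodSet ν R B₀)
    (hRmeas : ∀ g, Measurable (R g)) (hlam0 : 0 < lam) (hlam1 : lam < 1)
    (hT : IsMPAction (extMap (X := X) R B₀) (ν.prod (μ.prod (thetaZ lam))))
    {f f' : B × X × Fin N → ℝ} (hff' : f =ᵐ[ν.prod (μ.prod (thetaI lam N))] f') (ψ : B → ℝ) :
    (fun x => weightedMaximal ν R N F f ψ x) =ᵐ[μ] fun x => weightedMaximal ν R N F f' ψ x := by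
  set A : Set (B × X × Fin N) := toMeasurable (ν.prod (μ.prod (thetaI lam N))) {y | ¬ f y = f' y}
    with hA
  have hAm : MeasurableSet A := measurableSet_toMeasurable _ _
  have hA0 : (ν.prod (μ.prod (thetaI lam N))) A = 0 := by
    rw [hA, measure_toMeasurable]; exact hff'
  set d : B × X × Fin N → ℝ := A.indicator fun _ => 1 with hd
  have hdm : Measurable d := measurable_const.indicator hAm
  have hint : ∫⁻ z, ENNReal.ofReal (absExtend d z) ∂(ν.prod (μ.prod (thetaZ lam))) = 0 := by
    rw [lintegral_absExtend hlam0 hdm ENNReal.measurable_ofReal ENNReal.ofReal_zero]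
    have : ∫⁻ y, ENNReal.ofReal |d y| ∂(ν.prod (μ.prod (thetaI lam N))) = 0 := by
      rw [lintegral_eq_zero_iff hdm.abs.ennreal_ofReal]
      filter_upwards [measure_eq_zero_iff_ae_notMem.1 hA0] with y hy
      simp [hd, hy]
    rw [this, mul_zero]
  -- `v` counts the visits of an orbit to the null set `A`, and its integral vanishes by invariance.
  -- So for almost every `x`, for almost every `b`, the whole orbit avoids `A`; this treats all
  -- indices `r` at once, even uncountably many.
  set v : B × X × ℤ → ℝ≥0∞ := fun z => ∑' g : Γ, ENNReal.ofReal (absExtend d (extMap R B₀ g z))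
    with hv
  have hvm : Measurable v := Measurable.tsum fun g =>
    (measurable_absExtend hdm).ennreal_ofReal.comp (measurable_extMap h.measurableSet hRmeas g)
  have hv0 : ∫⁻ z, v z ∂(ν.prod (μ.prod (thetaZ lam))) = 0 := by
    have hm : ∀ g, AEMeasurable (fun z => ENNReal.ofReal (absExtend d (extMap R B₀ g z)))
        (ν.prod (μ.prod (thetaZ lam))) := fun g =>
      ((measurable_absExtend hdm).ennreal_ofReal.comp (hT.measurable g)).aemeasurable
    rw [lintegral_tsum hm, ENNReal.tsum_eq_zero]
    intro g
    rw [← hint]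
    exact (hT.measurePreserving g).lintegral_comp (measurable_absExtend hdm).ennreal_ofReal
  have hsum := lintegral_lintegral_sum_le (ν := ν) (μ := μ) hlam0 hlam1 N hvm
  rw [hv0, nonpos_iff_eq_zero, lintegral_eq_zero_iff] at hsum
  · filter_upwards [hsum] with x hx
    rw [Pi.zero_apply, lintegral_eq_zero_iff] at hx
    · rw [weightedMaximal_eq_iSup h, weightedMaximal_eq_iSup h]
      refine iSup_congr fun r => lintegral_congr_ae ?_
      filter_upwards [hx] with b hb
      congr 2
      refine Finset.sum_congr rfl fun t _ => ?_
      unfold liftAvg orbitAvg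
      refine setAvg_congr fun g _ => ?_
      have h1 : v (b, x, ((t : ℕ) : ℤ)) = 0 :=
        (Finset.sum_eq_zero_iff.1 hb) t (Finset.mem_univ t)
      have h2 := ENNReal.ofReal_eq_zero.1 (ENNReal.tsum_eq_zero.1 h1 g)
      revert h2
      refine absExtend_cases (N := N) (p := fun z => absExtend d z ≤ 0 →
        ENNReal.ofReal (absExtend f z) = ENNReal.ofReal (absExtend f' z)) ?_ ?_ _
      · intro b x t h0
        rw [absExtend_coe] at h0
        rw [absExtend_coe, absExtend_coe]
        by_cases hmem : (b, x, t) ∈ A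
        · simp only [hd, Set.indicator_of_mem hmem] at h0
          norm_num at h0
        · have : f (b, x, t) = f' (b, x, t) := by
            by_contra hne
            exact hmem (subset_toMeasurable _ _ hne)
          rw [this]
      · intro z hz _
        rw [absExtend_of_forall_ne f hz, absExtend_of_forall_ne f' hz]
    · exact Finset.measurable_sum _ fun t _ => hvm.comp (by fun_prop)
  · refine Measurable.lintegral_prod_left' (f := fun p : B × X =>
      ∑ t : Fin N, v (p.1, p.2, ((t : ℕ) : ℤ))) ?_
    exact Finset.measurable_sum _ fun t _ => hvm.comp (by fun_prop)

/-! ### Bounds for the maximal function on the extension -/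

omit [MeasurableConstSMul Γ X] in
lemma mul_measure_lt_liftMax_le (h : IsGoodSet ν R B₀) (hRmeas : ∀ g, Measurable (R g))
    (hmeas : ∀ i, MeasurableSet {z : (B × Fin N) × (B × Fin N) | z.2 ∈ F i z.1})
    (hT : IsMPAction (extMap (X := X) R B₀) (ν.prod (μ.prod (thetaZ lam))))
    {C : ℝ≥0} (hC : C ≠ 0)
    (hΦ : IsTemperedAction (extMap (X := X) R B₀) (extReturnSet X R B₀ F) (Set.range q) C)
    {f : B × X × Fin N → ℝ} (hf : Measurable f) (t : ℝ) (_ : 0 < t) :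
    ENNReal.ofReal t * (ν.prod (μ.prod (thetaZ lam)))
        {z | 2 * ENNReal.ofReal t < liftMax R B₀ F q f z} ≤
      2 * C * ∫⁻ z in {z | t < absExtend f z}, ENNReal.ofReal (absExtend f z)
        ∂(ν.prod (μ.prod (thetaZ lam))) := by
  have := mul_measure_two_mul_lt_orbitMax_le hT (ENNReal.coe_ne_zero.2 hC) ENNReal.coe_ne_top
    (fun i => measurableSet_extReturnSet h.measurableSet hRmeas (hmeas i)) hΦ
    (measurable_absExtend hf).ennreal_ofReal (ENNReal.ofReal t)
  have hset : {z : B × X × ℤ | ENNReal.ofReal t < ENNReal.ofReal (absExtend f z)} =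
      {z | t < absExtend f z} := by
    ext z
    exact ENNReal.ofReal_lt_ofReal_iff_of_nonneg (by positivity)
  rwa [hset] at this

/-- The strong type inequality for the maximal function on the extension. -/
lemma lintegral_liftMax_rpow_le [SFinite ν] [SFinite μ] (h : IsGoodSet ν R B₀)
    (hRmeas : ∀ g, Measurable (R g)) (hlam : 0 < lam)
    (hmeas : ∀ i, MeasurableSet {z : (B × Fin N) × (B × Fin N) | z.2 ∈ F i z.1})
    (hT : IsMPAction (extMap (X := X) R B₀) (ν.prod (μ.prod (thetaZ lam))))
    {C : ℝ≥0} (hC : C ≠ 0)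
    (hΦ : IsTemperedAction (extMap (X := X) R B₀) (extReturnSet X R B₀ F) (Set.range q) C)
    {f : B × X × Fin N → ℝ} (hf : Measurable f) {p : ℝ} (hp : 1 < p) :
    ∫⁻ z, liftMax R B₀ F q f z ^ p ∂(ν.prod (μ.prod (thetaZ lam))) ≤
      2 ^ p * (2 * C * (ENNReal.ofReal (p / (p - 1)) *
        (ENNReal.ofReal (∑ k : Fin N, lam⁻¹ ^ (k : ℕ)) *
          ∫⁻ y, ‖f y‖ₑ ^ p ∂(ν.prod (μ.prod (thetaI lam N)))))) := by
  have := lintegral_rpow_le_of_weakType (measurable_liftMax (q := q) h hRmeas hmeas hf)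
    (measurable_absExtend hf) (absExtend_nonneg f)
    (mul_measure_lt_liftMax_le h hRmeas hmeas hT hC hΦ hf) hp
  have hφ : Measurable fun s : ℝ => ENNReal.ofReal s ^ p := by fun_prop
  rw [lintegral_absExtend hlam hf hφ (by simp [show 0 < p by linarith])] at this
  simpa only [Real.enorm_eq_ofReal_abs] using this

/-- The `L log L` bound for the maximal function on the extension. -/
lemma lintegral_liftMax_le [IsProbabilityMeasure ν] [IsProbabilityMeasure μ] (h : IsGoodSet ν R B₀)
    (hRmeas : ∀ g, Measurable (R g)) (hlam : 0 < lam)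
    (hmeas : ∀ i, MeasurableSet {z : (B × Fin N) × (B × Fin N) | z.2 ∈ F i z.1})
    (hT : IsMPAction (extMap (X := X) R B₀) (ν.prod (μ.prod (thetaZ lam))))
    {C : ℝ≥0} (hC : C ≠ 0)
    (hΦ : IsTemperedAction (extMap (X := X) R B₀) (extReturnSet X R B₀ F) (Set.range q) C)
    {f : B × X × Fin N → ℝ} (hf : Measurable f) :
    ∫⁻ z, liftMax R B₀ F q f z ∂(ν.prod (μ.prod (thetaZ lam))) ≤
      2 * (ENNReal.ofReal (∑ k : Fin N, lam⁻¹ ^ (k : ℕ)) * thetaI lam N Set.univ +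
        2 * C * (ENNReal.ofReal (∑ k : Fin N, lam⁻¹ ^ (k : ℕ)) *
          ∫⁻ y, ENNReal.ofReal (|f y| * Real.posLog |f y|)
            ∂(ν.prod (μ.prod (thetaI lam N))))) := by
  have := lintegral_le_of_weakType (measurable_liftMax (q := q) h hRmeas hmeas hf)
    (measurable_absExtend hf) (absExtend_nonneg f)
    (mul_measure_lt_liftMax_le h hRmeas hmeas hT hC hΦ hf)
  have hφ : Measurable fun s : ℝ => ENNReal.ofReal (s * Real.posLog s) := by
    unfold Real.posLog; fun_prop
  rw [lintegral_absExtend hlam hf hφ (by simp)] at this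
  refine this.trans ?_
  gcongr
  -- At heights outside `I` the return sets are empty and the maximal function vanishes, so its
  -- support has finite measure.
  refine (measure_mono fun z hz => ?_).trans (measure_fin_le (N := N) hlam)
  by_contra hne
  refine hz (le_antisymm (iSup_le fun n => ?_) zero_le)
  have hempty : extReturnSet X R B₀ F (q n) z = ∅ := by
    ext g
    simp only [Set.mem_empty_iff_false, iff_false]
    rintro ⟨-, t, -, ht, -⟩
    exact hne ⟨t, ht⟩
  simp [orbitAvg, setAvg, hempty]

end WeightedMaximal

/-! ### The maximal inequalities -/

section Final

variable {Γ B X : Type*} [Group Γ] [MulAction Γ B] [MulAction Γ X]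
  [MeasurableSpace B] [MeasurableSpace X] {ν : Measure B} {μ : Measure X} {lam : ℝ} {N : ℕ}
  {R : Γ → B → ℤ} {B₀ : Set B} {𝕀 : Set ℝ} {F : 𝕀 → B × Fin N → Set (B × Fin N)} {q : ℕ → 𝕀}
  [Countable Γ] [MeasurableConstSMul Γ B] [MeasurableConstSMul Γ X]

lemma measurable_sum_liftMax (h : IsGoodSet ν R B₀) (hRmeas : ∀ g, Measurable (R g))
    (hmeas : ∀ i, MeasurableSet {z : (B × Fin N) × (B × Fin N) | z.2 ∈ F i z.1})
    {f : B × X × Fin N → ℝ} (hf : Measurable f) :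
    Measurable fun y : B × X => ∑ t : Fin N, liftMax R B₀ F q f (y.1, y.2, ((t : ℕ) : ℤ)) :=
  Finset.measurable_sum _ fun t _ => (measurable_liftMax h hRmeas hmeas hf).comp (by fun_prop)

omit [Group Γ] [MulAction Γ B] [MulAction Γ X] in
lemma lintegral_lintegral_sum_rpow_le [SFinite ν] [SFinite μ] (hlam0 : 0 < lam) (hlam1 : lam < 1)
    (N : ℕ) {M : B × X × ℤ → ℝ≥0∞} (hM : Measurable M) {p : ℝ} (hp : 1 ≤ p) :
    ∫⁻ x, ∫⁻ b, (∑ t : Fin N, M (b, x, ((t : ℕ) : ℤ))) ^ p ∂ν ∂μ ≤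
      (N : ℝ≥0∞) ^ (p - 1) * ∫⁻ z, M z ^ p ∂(ν.prod (μ.prod (thetaZ lam))) := by
  have hMp : Measurable fun z => (N : ℝ≥0∞) ^ (p - 1) * M z ^ p := (hM.pow_const p).const_mul _
  rw [← lintegral_const_mul _ (hM.pow_const p)]
  refine le_trans ?_ (lintegral_lintegral_sum_le hlam0 hlam1 N hMp)
  refine lintegral_mono fun x => lintegral_mono fun b => ?_
  rw [← Finset.mul_sum]
  simpa using ENNReal.rpow_sum_le_const_mul_sum_rpow (Finset.univ : Finset (Fin N))
    (fun t => M (b, x, ((t : ℕ) : ℤ))) hp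

/-- Hölder's inequality in the variable of the density. -/
lemma eLpNorm_weightedMaximal_le_of_lt_top [SFinite ν] [SFinite μ] (hN : 1 ≤ N)
    (h : IsGoodSet ν R B₀) (hRmeas : ∀ g, Measurable (R g)) (hlam0 : 0 < lam) (hlam1 : lam < 1)
    (hmeas : ∀ i, MeasurableSet {z : (B × Fin N) × (B × Fin N) | z.2 ∈ F i z.1})
    (hq : ∀ i, ∃ k : ℕ → ℕ, ∀ᵐ b ∂ν, ∀ t, ∀ᶠ j in atTop, F (q (k j)) (b, t) = F i (b, t))
    (hT : IsMPAction (extMap (X := X) R B₀) (ν.prod (μ.prod (thetaZ lam))))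
    {C : ℝ≥0} (hC : C ≠ 0)
    (hΦ : IsTemperedAction (extMap (X := X) R B₀) (extReturnSet X R B₀ F) (Set.range q) C)
    {f : B × X × Fin N → ℝ} (hf : Measurable f) {ψ : B → ℝ} (hψ : AEMeasurable ψ ν)
    {p p' : ℝ≥0∞} (hp : 1 < p) (hp_top : p ≠ ∞) (hpp' : ENNReal.HolderConjugate p p') :
    eLpNorm (weightedMaximal ν R N F f ψ) p μ ≤
      ((N : ℝ≥0∞) ^ (p.toReal - 1) * (2 ^ p.toReal * (2 * C *
        (ENNReal.ofReal (p.toReal / (p.toReal - 1)) *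
          ENNReal.ofReal (∑ k : Fin N, lam⁻¹ ^ (k : ℕ)))))) ^ (1 / p.toReal) *
      eLpNorm ψ p' ν * eLpNorm f p (ν.prod (μ.prod (thetaI lam N))) := by
  have hp1 : 1 < p.toReal := by
    rw [← ENNReal.toReal_one]
    exact (ENNReal.toReal_lt_toReal ENNReal.one_ne_top hp_top).2 hp
  have hp0 : 0 < p.toReal := by linarith
  have hconj : p.toReal.HolderConjugate p'.toReal := ENNReal.HolderConjugate.toReal hp1
  have hp'0 : 0 < p'.toReal := hconj.symm.pos
  have hp'ne : p' ≠ 0 ∧ p' ≠ ∞ := (ENNReal.toReal_pos_iff.1 hp'0).imp ne_of_gt ne_of_lt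
  set E := eLpNorm ψ p' ν with hE
  set G : B × X → ℝ≥0∞ := fun y =>
    ∑ t : Fin N, liftMax R B₀ F q f (y.1, y.2, ((t : ℕ) : ℤ)) with hG
  have hGm : Measurable G := measurable_sum_liftMax h hRmeas hmeas hf
  have hpt : ∀ x, weightedMaximal ν R N F f ψ x ^ p.toReal ≤
      (∫⁻ b, G (b, x) ^ p.toReal ∂ν) * E ^ p.toReal := by
    intro x
    have hGx : Measurable fun b => G (b, x) := hGm.comp measurable_prodMk_right
    have h1 : weightedMaximal ν R N F f ψ x ≤
        (∫⁻ b, G (b, x) ^ p.toReal ∂ν) ^ (1 / p.toReal) * E := by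
      refine (weightedMaximal_le hN h hRmeas hmeas hq hf hψ x).trans ?_
      refine (ENNReal.lintegral_mul_le_Lp_mul_Lq ν hconj hGx.aemeasurable
        hψ.ennreal_ofReal).trans ?_
      rw [hE, eLpNorm_eq_lintegral_rpow_enorm_toReal hp'ne.1 hp'ne.2]
      gcongr
      exact Real.ofReal_le_enorm _
    calc weightedMaximal ν R N F f ψ x ^ p.toReal
        ≤ ((∫⁻ b, G (b, x) ^ p.toReal ∂ν) ^ (1 / p.toReal) * E) ^ p.toReal := by gcongr
      _ = _ := by
        rw [ENNReal.mul_rpow_of_nonneg _ _ hp0.le, ← ENNReal.rpow_mul,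
          one_div_mul_cancel hp0.ne', ENNReal.rpow_one]
  have hGpm : Measurable fun y => G y ^ p.toReal := hGm.pow_const _
  set A : ℝ≥0∞ := (N : ℝ≥0∞) ^ (p.toReal - 1) * (2 ^ p.toReal * (2 * C *
    (ENNReal.ofReal (p.toReal / (p.toReal - 1)) *
      ENNReal.ofReal (∑ k : Fin N, lam⁻¹ ^ (k : ℕ))))) with hA
  set J : ℝ≥0∞ := ∫⁻ y, ‖f y‖ₑ ^ p.toReal ∂(ν.prod (μ.prod (thetaI lam N))) with hJ
  have hGle : ∫⁻ x, ∫⁻ b, G (b, x) ^ p.toReal ∂ν ∂μ ≤ A * J := by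
    refine (lintegral_lintegral_sum_rpow_le hlam0 hlam1 N
      (measurable_liftMax h hRmeas hmeas hf) hp1.le).trans ?_
    refine (mul_le_mul_right
      (lintegral_liftMax_rpow_le h hRmeas hlam0 hmeas hT hC hΦ hf hp1) _).trans (le_of_eq ?_)
    rw [hA]
    simp only [mul_assoc, hJ]
  have hint : ∫⁻ x, weightedMaximal ν R N F f ψ x ^ p.toReal ∂μ ≤ A * E ^ p.toReal * J := by
    calc ∫⁻ x, weightedMaximal ν R N F f ψ x ^ p.toReal ∂μ
        ≤ ∫⁻ x, (∫⁻ b, G (b, x) ^ p.toReal ∂ν) * E ^ p.toReal ∂μ := lintegral_mono hpt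
      _ = (∫⁻ x, ∫⁻ b, G (b, x) ^ p.toReal ∂ν ∂μ) * E ^ p.toReal :=
          lintegral_mul_const _ (Measurable.lintegral_prod_left' hGpm)
      _ ≤ A * J * E ^ p.toReal := by gcongr
      _ = A * E ^ p.toReal * J := by ring
  have hp_ne : p ≠ 0 := (zero_lt_one.trans hp).ne'
  rw [eLpNorm_eq_lintegral_rpow_enorm_toReal hp_ne hp_top,
    eLpNorm_eq_lintegral_rpow_enorm_toReal hp_ne hp_top]
  simp only [enorm_eq_self]
  refine (ENNReal.rpow_le_rpow hint (by positivity)).trans (le_of_eq ?_)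
  rw [ENNReal.mul_rpow_of_nonneg _ _ (by positivity), ENNReal.mul_rpow_of_nonneg _ _ (by positivity),
    ← ENNReal.rpow_mul E, mul_one_div_cancel hp0.ne', ENNReal.rpow_one]

lemma eLpNorm_top_weightedMaximal_le [SFinite ν] [SFinite μ] (hN : 1 ≤ N)
    (h : IsGoodSet ν R B₀) (hRmeas : ∀ g, Measurable (R g)) (hlam0 : 0 < lam) (hlam1 : lam < 1)
    (hmeas : ∀ i, MeasurableSet {z : (B × Fin N) × (B × Fin N) | z.2 ∈ F i z.1})
    (hq : ∀ i, ∃ k : ℕ → ℕ, ∀ᵐ b ∂ν, ∀ t, ∀ᶠ j in atTop, F (q (k j)) (b, t) = F i (b, t))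
    (hT : IsMPAction (extMap (X := X) R B₀) (ν.prod (μ.prod (thetaZ lam))))
    {f : B × X × Fin N → ℝ} (hf : Measurable f)
    (hf_top : eLpNorm f ∞ (ν.prod (μ.prod (thetaI lam N))) ≠ ∞)
    {ψ : B → ℝ} (hψ : AEMeasurable ψ ν) :
    eLpNorm (weightedMaximal ν R N F f ψ) ∞ μ ≤
      N * eLpNorm ψ 1 ν * eLpNorm f ∞ (ν.prod (μ.prod (thetaI lam N))) := by
  set K := eLpNorm f ∞ (ν.prod (μ.prod (thetaI lam N))) with hK
  -- Truncation at the essential supremum changes `f` on a null set only, and makes the bound hold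
  -- at every point of every orbit.
  set f' : B × X × Fin N → ℝ := fun y => max (min (f y) K.toReal) (-K.toReal) with hf'
  have hK0 : 0 ≤ K.toReal := ENNReal.toReal_nonneg
  have hf'm : Measurable f' := (hf.min measurable_const).max measurable_const
  have hf'K : ∀ y, |f' y| ≤ K.toReal := fun y =>
    abs_le.2 ⟨le_max_right _ _, max_le (min_le_right _ _) (by linarith)⟩
  have hff' : f =ᵐ[ν.prod (μ.prod (thetaI lam N))] f' := by
    have hle : ∀ᵐ y ∂(ν.prod (μ.prod (thetaI lam N))), ‖f y‖ₑ ≤ K := by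
      rw [hK, eLpNorm_exponent_top]; exact ae_le_eLpNormEssSup
    filter_upwards [hle] with y hy
    have : |f y| ≤ K.toReal := by
      rw [← ENNReal.ofReal_le_iff_le_toReal hf_top, ← Real.enorm_eq_ofReal_abs]
      exact hy
    rw [hf']
    simp only
    rw [min_eq_left (abs_le.1 this).2, max_eq_left (abs_le.1 this).1]
  rw [eLpNorm_exponent_top]
  refine eLpNormEssSup_le_of_ae_enorm_bound ?_
  filter_upwards [weightedMaximal_congr_ae h hRmeas hlam0 hlam1 hT hff' ψ] with x hx
  rw [enorm_eq_self, hx]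
  calc weightedMaximal ν R N F f' ψ x
      ≤ ∫⁻ b, (∑ t : Fin N, liftMax R B₀ F q f' (b, x, ((t : ℕ) : ℤ))) * ENNReal.ofReal (ψ b) ∂ν :=
        weightedMaximal_le hN h hRmeas hmeas hq hf'm hψ x
    _ ≤ ∫⁻ b, (N * K) * ‖ψ b‖ₑ ∂ν := by
        gcongr with b
        · refine (Finset.sum_le_card_nsmul _ _ (ENNReal.ofReal K.toReal) fun t _ =>
            liftMax_le_of_forall_le hf'K hK0 _).trans ?_
          rw [ENNReal.ofReal_toReal hf_top]
          simp
        · exact Real.ofReal_le_enorm _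
    _ = N * eLpNorm ψ 1 ν * K := by
        rw [lintegral_const_mul'' _ hψ.enorm, eLpNorm_one_eq_lintegral_enorm]
        ring

/-- The `L log L` estimate on the extension is not homogeneous. It is applied to `f / c`, whose
`log⁺` integral is at most `1`, so that its right side is a constant; homogeneity of the maximal
function restores `c`. -/
lemma eLpNorm_one_weightedMaximal_le [IsProbabilityMeasure ν] [IsProbabilityMeasure μ] (hN : 1 ≤ N)
    (h : IsGoodSet ν R B₀) (hRmeas : ∀ g, Measurable (R g)) (hlam0 : 0 < lam) (hlam1 : lam < 1)
    (hmeas : ∀ i, MeasurableSet {z : (B × Fin N) × (B × Fin N) | z.2 ∈ F i z.1})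
    (hq : ∀ i, ∃ k : ℕ → ℕ, ∀ᵐ b ∂ν, ∀ t, ∀ᶠ j in atTop, F (q (k j)) (b, t) = F i (b, t))
    (hT : IsMPAction (extMap (X := X) R B₀) (ν.prod (μ.prod (thetaZ lam))))
    {C : ℝ≥0} (hC : C ≠ 0)
    (hΦ : IsTemperedAction (extMap (X := X) R B₀) (extReturnSet X R B₀ F) (Set.range q) C)
    {f : B × X × Fin N → ℝ} (hf : Measurable f) {ψ : B → ℝ} (hψ : AEMeasurable ψ ν)
    {c : ℝ} (hc : 0 < c)
    (hfc : ∫⁻ y, ENNReal.ofReal (|f y| / c * Real.posLog (|f y| / c))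
      ∂(ν.prod (μ.prod (thetaI lam N))) ≤ 1) :
    eLpNorm (weightedMaximal ν R N F f ψ) 1 μ ≤
      2 * (ENNReal.ofReal (∑ k : Fin N, lam⁻¹ ^ (k : ℕ)) * thetaI lam N Set.univ +
        2 * C * ENNReal.ofReal (∑ k : Fin N, lam⁻¹ ^ (k : ℕ))) *
      eLpNorm ψ ∞ ν * ENNReal.ofReal c := by
  set f₁ : B × X × Fin N → ℝ := fun y => f y / c with hf₁
  have hf₁m : Measurable f₁ := hf.div_const c
  have hff₁ : f = fun y => c * f₁ y := by
    ext y; rw [hf₁]; field_simp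
  have hMm := measurable_liftMax (q := q) h hRmeas hmeas hf
  have hψle : ∀ᵐ b ∂ν, ENNReal.ofReal (ψ b) ≤ eLpNorm ψ ∞ ν := by
    rw [eLpNorm_exponent_top]
    filter_upwards [ae_le_eLpNormEssSup (f := ψ) (μ := ν)] with b hb
    exact (Real.ofReal_le_enorm _).trans hb
  set G : B × X → ℝ≥0∞ := fun y =>
    ∑ t : Fin N, liftMax R B₀ F q f (y.1, y.2, ((t : ℕ) : ℤ)) with hG
  have hGm : Measurable G := measurable_sum_liftMax h hRmeas hmeas hf
  rw [eLpNorm_one_eq_lintegral_enorm]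
  simp only [enorm_eq_self]
  calc ∫⁻ x, weightedMaximal ν R N F f ψ x ∂μ
      ≤ ∫⁻ x, (∫⁻ b, G (b, x) ∂ν) * eLpNorm ψ ∞ ν ∂μ := by
        refine lintegral_mono fun x => ?_
        refine (weightedMaximal_le hN h hRmeas hmeas hq hf hψ x).trans ?_
        have hGx : Measurable fun b => G (b, x) := hGm.comp measurable_prodMk_right
        rw [← lintegral_mul_const _ hGx]
        refine lintegral_mono_ae ?_
        filter_upwards [hψle] with b hb
        gcongr
    _ = (∫⁻ x, ∫⁻ b, G (b, x) ∂ν ∂μ) * eLpNorm ψ ∞ ν := lintegral_mul_const _ (Measurable.lintegral_prod_left' hGm)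
    _ ≤ (∫⁻ z, liftMax R B₀ F q f z ∂(ν.prod (μ.prod (thetaZ lam)))) * eLpNorm ψ ∞ ν := by
        gcongr
        exact lintegral_lintegral_sum_le hlam0 hlam1 N hMm
    _ = ENNReal.ofReal c * (∫⁻ z, liftMax R B₀ F q f₁ z ∂(ν.prod (μ.prod (thetaZ lam)))) *
          eLpNorm ψ ∞ ν := by
        rw [← lintegral_const_mul _ (measurable_liftMax h hRmeas hmeas hf₁m)]
        congr 1
        refine lintegral_congr fun z => ?_
        rw [hff₁, liftMax_const_mul hc.le]
    _ ≤ ENNReal.ofReal c * (2 * (ENNReal.ofReal (∑ k : Fin N, lam⁻¹ ^ (k : ℕ)) *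
          thetaI lam N Set.univ + 2 * C * (ENNReal.ofReal (∑ k : Fin N, lam⁻¹ ^ (k : ℕ)) * 1))) *
          eLpNorm ψ ∞ ν := by
        gcongr
        refine (lintegral_liftMax_le h hRmeas hlam0 hmeas hT hC hΦ hf₁m).trans ?_
        gcongr
        simpa only [hf₁, abs_div, abs_of_pos hc] using hfc
    _ = _ := by ring

end Final

theorem mainTheorem9 {Γ : Type*} [Group Γ] [Countable Γ]
    {B : Type*} [MeasurableSpace B] [StandardBorelSpace B] [MulAction Γ B]
    [MeasurableConstSMul Γ B] (ν : Measure B) [IsProbabilityMeasure ν]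
    (hν : ∀ g : Γ, Measure.QuasiMeasurePreserving (fun b : B => g • b) ν ν)
    (hfree : ∀ᵐ b ∂ν, ∀ g : Γ, g • b = b → g = 1)
    (lam : ℝ) (hlam0 : 0 < lam) (hlam1 : lam < 1)
    (R : Γ → B → ℤ) (hRmeas : ∀ g, Measurable (R g))
    (hR : ∀ g, ∀ᵐ b ∂ν, (R g b : ℝ) = logRN ν lam g b)
    (N : ℕ) (hN : 1 ≤ N)
    (𝕀 : Set ℝ) (h𝕀 : 𝕀 = posNatIndex ∨ 𝕀 = Set.Ioi 0)
    (F : 𝕀 → B × Fin N → Set (B × Fin N))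
    (hF : IsBorelFamily (maharamRelI R N) 𝕀 F)
    (hF' : IsRegularFamily (ν.prod (thetaI lam N)) F ∨
      (IsAsymptoticallyInvariant (maharamRelI R N) (ν.prod (thetaI lam N)) F ∧
        IsUniformFamily (ν.prod (thetaI lam N)) F ∧
        IsTemperedFamily (ν.prod (thetaI lam N)) F)) :
    (∀ p q : ℝ≥0∞, 1 < p → ENNReal.HolderConjugate p q →
      ∃ C : ℝ≥0, ∀ (X : Type*) [MeasurableSpace X] [StandardBorelSpace X] [MulAction Γ X]
        [MeasurableConstSMul Γ X] (μ : Measure X) [IsProbabilityMeasure μ]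
        [SMulInvariantMeasure Γ X μ] (f : B × X × Fin N → ℝ) (ψ : B → ℝ),
        MemLp f p (ν.prod (μ.prod (thetaI lam N))) → IsProbDensity ψ ν → MemLp ψ q ν →
          AEMeasurable (weightedMaximal ν R N F f ψ) μ ∧
          eLpNorm (weightedMaximal ν R N F f ψ) p μ ≤
            C * eLpNorm ψ q ν * eLpNorm f p (ν.prod (μ.prod (thetaI lam N)))) ∧
    (∃ C : ℝ≥0, ∀ (X : Type*) [MeasurableSpace X] [StandardBorelSpace X] [MulAction Γ X]
      [MeasurableConstSMul Γ X] (μ : Measure X) [IsProbabilityMeasure μ]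
      [SMulInvariantMeasure Γ X μ] (f : B × X × Fin N → ℝ) (ψ : B → ℝ),
      MemLLogL f (ν.prod (μ.prod (thetaI lam N))) → IsProbDensity ψ ν → MemLp ψ ∞ ν →
        AEMeasurable (weightedMaximal ν R N F f ψ) μ ∧
        eLpNorm (weightedMaximal ν R N F f ψ) 1 μ ≤
          C * eLpNorm ψ ∞ ν * lLogLNorm f (ν.prod (μ.prod (thetaI lam N)))) := by
  have hcoc := ae_cocycle hν hlam0 hlam1 hRmeas hR
  have hclass : ∀ i x, ∀ y ∈ F i x, maharamRelI R N x y := hF.subset_class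
  have hfin : ∀ i x, (F i x).Finite := fun i x =>
    (hF.finite i x).subset (Set.subset_iUnion₂ (s := fun s (_ : s ≤ i) => F s x) i le_rfl)
  have hmeas : ∀ i, MeasurableSet {z : (B × Fin N) × (B × Fin N) | z.2 ∈ F i z.1} := by
    intro i
    have hm : Measurable fun z : (B × Fin N) × (B × Fin N) => (z.1, z.2, i) := by fun_prop
    exact hm hF.measurable
  have hne : Nonempty 𝕀 := by
    rcases h𝕀 with rfl | rfl
    · exact ⟨⟨_, 0, rfl⟩⟩
    · exact ⟨⟨1, Set.mem_Ioi.2 one_pos⟩⟩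
  obtain ⟨C, hC, hall⟩ := exists_isTemperedOn hlam0 hν hfree hcoc hF
    (hF'.imp_right fun h => h.2)
  -- The sequence `q` is built with a preliminary good set, but its property `hq` concerns `F`
  -- alone. It therefore remains available with the good set `B₀`, which carries the conditions
  -- along `q`.
  obtain ⟨B₁, hB₁, -⟩ := exists_isGoodSet hν hfree hcoc (p := fun _ => True) (by simp)
  obtain ⟨q, hq⟩ := hB₁.exists_seq_index hlam0 hRmeas hclass hfin hmeas
  obtain ⟨B₀, hB₀, hFq⟩ := hall q
  set s : ℝ≥0∞ := ENNReal.ofReal (∑ k : Fin N, lam⁻¹ ^ (k : ℕ)) with hs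
  have hs_top : s ≠ ∞ := ENNReal.ofReal_ne_top
  refine ⟨fun p p' hp hpp' => ?_, ?_⟩
  · by_cases hp_top : p = ∞
    · subst hp_top
      have hp' : p' = 1 := (ENNReal.HolderConjugate.eq_top_iff_eq_one ∞ p').1 rfl
      subst hp'
      refine ⟨N, ?_⟩
      intro X _ _ _ _ μ _ _ f ψ hf hψ _
      have hT := hB₀.isMPAction_extMap (μ := μ) hν hlam0 hlam1 hRmeas hR
      have hψm := hψ.1.aestronglyMeasurable.aemeasurable
      have hf' := hf.1.aemeasurable.ae_eq_mk
      have hW := weightedMaximal_congr_ae hB₀ hRmeas hlam0 hlam1 hT hf' ψ (F := F)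
      refine ⟨⟨_, measurable_weightedMaximal hB₀ hRmeas hmeas hq
        hf.1.aemeasurable.measurable_mk hψm, hW⟩, ?_⟩
      have htop := hf.2.ne
      rw [eLpNorm_congr_ae hf'] at htop ⊢
      rw [eLpNorm_congr_ae hW]
      exact eLpNorm_top_weightedMaximal_le hN hB₀ hRmeas hlam0 hlam1 hmeas hq hT
        hf.1.aemeasurable.measurable_mk htop hψm
    -- `K` involves only `N`, `lam`, `p` and `C`, all fixed before the action on `X`.
    · set K : ℝ≥0∞ := ((N : ℝ≥0∞) ^ (p.toReal - 1) * (2 ^ p.toReal * (2 * C *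
        (ENNReal.ofReal (p.toReal / (p.toReal - 1)) * s)))) ^ (1 / p.toReal) with hK
      have hp1 : 1 < p.toReal := by
        rw [← ENNReal.toReal_one]
        exact (ENNReal.toReal_lt_toReal ENNReal.one_ne_top hp_top).2 hp
      have hK_top : K ≠ ∞ := by
        refine ENNReal.rpow_ne_top_of_nonneg (by positivity) ?_
        refine ENNReal.mul_ne_top (ENNReal.rpow_ne_top_of_nonneg (by linarith)
          (ENNReal.natCast_ne_top N)) (ENNReal.mul_ne_top
          (ENNReal.rpow_ne_top_of_nonneg (by linarith) ENNReal.ofNat_ne_top) ?_)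
        exact ENNReal.mul_ne_top (ENNReal.mul_ne_top ENNReal.ofNat_ne_top ENNReal.coe_ne_top)
          (ENNReal.mul_ne_top ENNReal.ofReal_ne_top hs_top)
      refine ⟨K.toNNReal, ?_⟩
      intro X _ _ _ _ μ _ _ f ψ hf hψ _
      have hT := hB₀.isMPAction_extMap (μ := μ) hν hlam0 hlam1 hRmeas hR
      have hψm := hψ.1.aestronglyMeasurable.aemeasurable
      have hf' := hf.1.aemeasurable.ae_eq_mk
      have hW := weightedMaximal_congr_ae hB₀ hRmeas hlam0 hlam1 hT hf' ψ (F := F)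
      refine ⟨⟨_, measurable_weightedMaximal hB₀ hRmeas hmeas hq
        hf.1.aemeasurable.measurable_mk hψm, hW⟩, ?_⟩
      rw [eLpNorm_congr_ae hf', eLpNorm_congr_ae hW, ENNReal.coe_toNNReal hK_top]
      exact eLpNorm_weightedMaximal_le_of_lt_top hN hB₀ hRmeas hlam0 hlam1 hmeas hq hT hC
        (hFq.isTemperedAction hB₀ hclass hfin) hf.1.aemeasurable.measurable_mk hψm hp hp_top hpp'
  · set K : ℝ≥0∞ := 2 * (s * thetaI lam N Set.univ + 2 * C * s) with hK
    have hK_top : K ≠ ∞ := by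
      refine ENNReal.mul_ne_top ENNReal.ofNat_ne_top (ENNReal.add_ne_top.2
        ⟨ENNReal.mul_ne_top hs_top (measure_ne_top _ _), ?_⟩)
      exact ENNReal.mul_ne_top (ENNReal.mul_ne_top ENNReal.ofNat_ne_top ENNReal.coe_ne_top) hs_top
    -- The summand `1` makes the constant visibly nonzero. Together with `∫ ψ = 1`, which excludes
    -- `ψ = 0` almost everywhere, it permits the division needed to pass to the infimum over `c`
    -- defining the norm.
    refine ⟨K.toNNReal + 1, ?_⟩
    intro X _ _ _ _ μ _ _ f ψ hf hψ hψ_top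
    have hT := hB₀.isMPAction_extMap (μ := μ) hν hlam0 hlam1 hRmeas hR
    have hψm := hψ.1.aestronglyMeasurable.aemeasurable
    have hf' := hf.1.aemeasurable.ae_eq_mk
    have hW := weightedMaximal_congr_ae hB₀ hRmeas hlam0 hlam1 hT hf' ψ (F := F)
    refine ⟨⟨_, measurable_weightedMaximal hB₀ hRmeas hmeas hq
      hf.1.aemeasurable.measurable_mk hψm, hW⟩, ?_⟩
    have hψ0 : eLpNorm ψ ∞ ν ≠ 0 := by
      intro h0
      rw [eLpNorm_eq_zero_iff hψ.1.aestronglyMeasurable ENNReal.top_ne_zero] at h0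
      have := hψ.2.2
      rw [integral_congr_ae h0] at this
      simp at this
    rw [ENNReal.coe_add, ENNReal.coe_toNNReal hK_top, ENNReal.coe_one, eLpNorm_congr_ae hW]
    have ha0 : (K + 1) * eLpNorm ψ ∞ ν ≠ 0 := mul_ne_zero (by simp) hψ0
    have ha_top : (K + 1) * eLpNorm ψ ∞ ν ≠ ∞ :=
      ENNReal.mul_ne_top (ENNReal.add_ne_top.2 ⟨hK_top, ENNReal.one_ne_top⟩) hψ_top.2.ne
    rw [mul_comm, ← ENNReal.div_le_iff ha0 ha_top]
    refine le_sInf ?_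
    rintro - ⟨c, hc, rfl, hfc⟩
    rw [ENNReal.div_le_iff ha0 ha_top, mul_comm]
    have hfc' : ∫⁻ y, ENNReal.ofReal (|hf.1.aemeasurable.mk f y| / c *
        Real.posLog (|hf.1.aemeasurable.mk f y| / c)) ∂(ν.prod (μ.prod (thetaI lam N))) ≤ 1 := by
      refine le_trans (le_of_eq (lintegral_congr_ae ?_)) hfc
      filter_upwards [hf'] with y hy
      rw [hy]
    refine (eLpNorm_one_weightedMaximal_le hN hB₀ hRmeas hlam0 hlam1 hmeas hq hT hC
      (hFq.isTemperedAction hB₀ hclass hfin) hf.1.aemeasurable.measurable_mk hψm hc hfc').trans ?_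
    gcongr
    exact le_self_add
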